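/- Setup. Let $\mu$ be a measure on $\mathbb R$ and $p_0$ a probability density with respect to $\mu$. Put $\kappa(\theta)=\log\int e^{\theta x}p_0(x)\,d\mu(x)$, $\Theta=\{\theta:\int e^{\theta x}p_0\,d\mu<\infty\}$ and $p_\theta(x)=e^{\theta x-\kappa(\theta)}p_0(x)$. Let $M\in(0,\infty]$ with $\Theta_0=\{|\theta|\le M\}\subseteq\Theta$, let $\mathcal G$ be the set of probability measures $g$ with $\mathrm{supp}(g)\subseteq\Theta_0$, and let $f_g=\int p_\theta\,dg(\theta)$, $l_g(x)=\int e^{\theta x-\kappa(\theta)}\,dg(\theta)$. Let $X_1,X_2,\dots$ be i.i.d. with density $f_{g_0}$ with respect to $\mu$, for some $g_0\in\mathcal G$. Write $|X|_n=\max_{i\le n}|X_i|$, $\ell_n(f)=\sum_{i\le n}\log f(X_i)$, and $P_n$ for the empirical measure. An NPMLE $\hat g$ is any maximizer of $\ell_n(f_g)$ over $g\in\mathcal G$. For a positive integer $J$, an order-$J$ Gaussian quadrature rule $P_J$ of $P_n$ is a probability measure carried by at most $J$ points with the same first $2J-1$ moments as $P_n$, and $\hat g_J$ is any maximizer of $\int\log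 l_g\,dP_J$ over $g\in\mathcal G$. For $C,m,\delta>0$ set $$J_n(C,m,\delta)=\max\Big\{1,\Big\lceil 2|X|_n m\log\Big(\frac{C\,n|X|_n m\,(|X|_n m+\sup_{|\theta|\le m}|\kappa(\theta)|)}{\delta}\Big)\Big\rceil\Big\}$$ (interpreted as $1$ if $|X|_n m=0$). Scenario (S1): $M<\infty$ and $[-M-\tau,M+\tau]\subseteq\Theta$ for some $\tau>0$. Scenario (S2): $M=\infty$, $\int x\,p_0\,d\mu=0$, and there are $\alpha_1\ge\alpha_2>0$ and $c_0,c_1,c_2>0$ with $c_1|\theta|^{1+1/\alpha_1}\le\kappa(\theta)$ and $\kappa''(\theta)\le c_2|\theta|^{1/\alpha_2-1}$ for $|\theta|\ge c_0$. Condition (LT) with exponent $\beta_0>0$: there are $b_0,b_1>0$ with $\mathbb P(|X|_n\ge t)\le n\exp(-b_1t^{\beta_0})$ for all $n\ge1$, $t\ge b_0$. Corollary. There is a universal constant $C>0$ such that the following holds for every $\gamma>0$ and every sequence $\Delta_n>0$ of exact order $n^{-\gamma}$ (that is, $\Delta_n=O(n^{-\gamma})$ and $n^{-\gamma}=O(\Delta_n)$).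 (1) Assume (S1) and let $M_n\equiv m$ for a constant $m\ge M$ with $[-m,m]\subseteq\Theta$ (for example $m=M$). Put $J_n=J_n(C,m,\Delta_n)$. Almost surely, for every $n\ge1$ with $|X|_nm\ge1$, all $\hat g$, all order-$J_n$ quadrature rules of $P_n$ and all corresponding $\hat g_{J_n}$ satisfy $\mathrm{supp}(\hat g)\cup\mathrm{supp}(\hat g_{J_n})\subseteq[-m,m]$ and $\ell_n(f_{\hat g})-\ell_n(f_{\hat g_{J_n}})\le\Delta_n$. Moreover $J_n=O_{\mathbb P}((\log n)^2)$. (2) Assume (S2). There is $A_0>0$, depending only on $p_0$ and $\mu$ and on $\alpha_1,\alpha_2$, such that for every constant $A\ge A_0$, every $g_0$ for which (LT) holds with some exponent $\beta_0>0$, and $M_n=A|X|_n^{\alpha_1}$, $J_n=J_n(C,M_n,\Delta_n)$: almost surely, for every $n\ge1$ with $|X|_n\ge1$, all $\hat g$, all order-$J_n$ quadrature rules of $P_n$ and all corresponding $\hat g_{J_n}$ satisfy $\mathrm{supp}(\hat g)\cup\mathrm{supp}(\hat g_{J_n})\subseteq[-M_n,M_n]$ and $\ell_n(f_{\hat g})-\ell_n(f_{\hat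 g_{J_n}})\le\Delta_n$; almost surely $|X|_n\ge1$ for all large $n$; and $J_n=O_{\mathbb P}\big((\log n)^{1+(1+\alpha_1)/\beta_0}\big)$. -/

import Mathlib

open MeasureTheory ProbabilityTheory Filter Topology Asymptotics
open scoped ENNReal

namespace NPMLE

noncomputable section

/-- `p₀` is a probability density with respect to `μ`. -/
structure IsBaseDensity (μ : Measure ℝ) (p₀ : ℝ → ℝ) : Prop where
  measurable : Measurable p₀
  nonneg : ∀ x, 0 ≤ p₀ x
  lintegral_eq_one : ∫⁻ x, ENNReal.ofReal (p₀ x) ∂μ = 1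

/-- The probability measure `p₀ dμ`. -/
def baseMeasure (μ : Measure ℝ) (p₀ : ℝ → ℝ) : Measure ℝ :=
  μ.withDensity fun x => ENNReal.ofReal (p₀ x)

/-- The cumulant generating function `κ(θ) = log ∫ exp (θ x) p₀(x) dμ(x)`. -/
def kappa (μ : Measure ℝ) (p₀ : ℝ → ℝ) : ℝ → ℝ :=
  cgf id (baseMeasure μ p₀)

/-- The canonical parameter space `Θ = {θ | ∫ exp (θ x) p₀(x) dμ(x) < ∞}`. -/
def canonicalSpace (μ : Measure ℝ) (p₀ : ℝ → ℝ) : Set ℝ :=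
  integrableExpSet id (baseMeasure μ p₀)

/-- The exponential family density `p_θ(x) = exp (θ x - κ(θ)) p₀(x)`. -/
def expDensity (μ : Measure ℝ) (p₀ : ℝ → ℝ) (θ x : ℝ) : ℝ :=
  Real.exp (θ * x - kappa μ p₀ θ) * p₀ x

/-- The mixture density `f_g(x) = ∫ p_θ(x) dg(θ)`. -/
def mixDensity (μ : Measure ℝ) (p₀ : ℝ → ℝ) (g : Measure ℝ) (x : ℝ) : ℝ :=
  ∫ θ, expDensity μ p₀ θ x ∂g

/-- The likelihood ratio function `l_g(x) = ∫ exp (θ x - κ(θ)) dg(θ)`. -/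
def likRatio (μ : Measure ℝ) (p₀ : ℝ → ℝ) (g : Measure ℝ) (x : ℝ) : ℝ :=
  ∫ θ, Real.exp (θ * x - kappa μ p₀ θ) ∂g

/-- The known parameter set `Θ₀ = {θ | |θ| ≤ M}`, where `M = ⊤` is allowed. -/
def paramSet (M : EReal) : Set ℝ := {θ | ((|θ| : ℝ) : EReal) ≤ M}

/-- The class `𝒢` of mixing distributions with support in `Θ₀ = {|θ| ≤ M}`. -/
def mixingClass (M : EReal) : Set (Measure ℝ) :=
  {g | IsProbabilityMeasure g ∧ g.support ⊆ paramSet M}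

/-- The exponential family setup (without the sampling part, which is `IsIIDSample`). -/
structure IsExpFamily (μ : Measure ℝ) (p₀ : ℝ → ℝ) (M : EReal) : Prop where
  density : IsBaseDensity μ p₀
  pos : 0 < M
  subset : paramSet M ⊆ canonicalSpace μ p₀

/-- The scenario of a bounded parameter set. -/
structure ScenarioOne (μ : Measure ℝ) (p₀ : ℝ → ℝ) (M : ℝ) : Prop where
  expFamily : IsExpFamily μ p₀ (M : EReal)
  margin : ∃ τ : ℝ, 0 < τ ∧ Set.Icc (-M - τ) (M + τ) ⊆ canonicalSpace μ p₀

/-- The scenario of an unbounded parameter set (`M = ∞`). -/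
structure ScenarioTwo (μ : Measure ℝ) (p₀ : ℝ → ℝ) (α₁ α₂ : ℝ) : Prop where
  expFamily : IsExpFamily μ p₀ ⊤
  mean_zero : ∫ x, x * p₀ x ∂μ = 0
  pos : 0 < α₂
  le : α₂ ≤ α₁
  growth : ∃ c₀ c₁ c₂ : ℝ, 0 < c₀ ∧ 0 < c₁ ∧ 0 < c₂ ∧ ∀ θ : ℝ, c₀ ≤ |θ| →
    c₁ * |θ| ^ (1 + 1 / α₁) ≤ kappa μ p₀ θ ∧
      iteratedDeriv 2 (kappa μ p₀) θ ≤ c₂ * |θ| ^ (1 / α₂ - 1)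

/-- `X 0, X 1, …` are i.i.d. with density `f_{g₀}` with respect to `μ`. -/
structure IsIIDSample {Ω : Type*} [MeasurableSpace Ω] (P : Measure Ω) (μ : Measure ℝ)
    (p₀ : ℝ → ℝ) (g₀ : Measure ℝ) (X : ℕ → Ω → ℝ) : Prop where
  indep : iIndepFun X P
  law : ∀ i, HasLaw (X i) (μ.withDensity fun x => ENNReal.ofReal (mixDensity μ p₀ g₀ x)) P

/-- The first `n` observations. -/
def sample {Ω : Type*} (X : ℕ → Ω → ℝ) (n : ℕ) (ω : Ω) : Fin n → ℝ := fun i => X i ω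

/-- `|X|_n = max_i |x_i|`. -/
def maxAbs {n : ℕ} (x : Fin n → ℝ) : ℝ := ⨆ i, |x i|

/-- The light-tail condition with exponent `β₀`. -/
def LightTail {Ω : Type*} [MeasurableSpace Ω] (P : Measure Ω) (X : ℕ → Ω → ℝ) (β₀ : ℝ) : Prop :=
  ∃ b₀ b₁ : ℝ, 0 < b₀ ∧ 0 < b₁ ∧ ∀ n : ℕ, 1 ≤ n → ∀ t : ℝ, b₀ ≤ t →
    P {ω | t ≤ maxAbs (sample X n ω)} ≤ ENNReal.ofReal (n * Real.exp (-b₁ * t ^ β₀))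

/-- The log-likelihood `ℓ_n(f) = ∑ i, log f(x_i)`. -/
def logLik {n : ℕ} (x : Fin n → ℝ) (f : ℝ → ℝ) : ℝ := ∑ i, Real.log (f (x i))

/-- The empirical measure `P_n`. -/
def empirical {n : ℕ} (x : Fin n → ℝ) : Measure ℝ :=
  (n : ℝ≥0∞)⁻¹ • ∑ i, Measure.dirac (x i)

/-- `Q` is an order-`J` Gaussian quadrature rule for `ν`: a probability measure carried by at
most `J` points with the same first `2 J - 1` moments. (If `ν` has at least `J` support points,
then `Q` has exactly `J` support points; otherwise `Q = ν`.) -/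
structure IsGaussQuadrature (J : ℕ) (ν Q : Measure ℝ) : Prop where
  prob : IsProbabilityMeasure Q
  finite_support : ∃ s : Finset ℝ, s.card ≤ J ∧ Q ((s : Set ℝ)ᶜ) = 0
  moments : ∀ k : ℕ, k ≤ 2 * J - 1 → (∫ x, x ^ k ∂Q) = ∫ x, x ^ k ∂ν

/-- `g` is an NPMLE: a maximizer of the log-likelihood `ℓ_n(f_g)` over `𝒢`. -/
def IsNPMLE (μ : Measure ℝ) (p₀ : ℝ → ℝ) (M : EReal) {n : ℕ} (x : Fin n → ℝ)
    (g : Measure ℝ) : Prop :=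
  g ∈ mixingClass M ∧ IsMaxOn (fun g' => logLik x (mixDensity μ p₀ g')) (mixingClass M) g

/-- `g` is a maximizer of `∫ log l_g dQ` over `𝒢`; for a quadrature rule `Q` of the empirical
measure this is the approximate NPMLE. -/
def IsApproxNPMLE (μ : Measure ℝ) (p₀ : ℝ → ℝ) (M : EReal) (Q : Measure ℝ)
    (g : Measure ℝ) : Prop :=
  g ∈ mixingClass M ∧
    IsMaxOn (fun g' => ∫ x, Real.log (likRatio μ p₀ g' x) ∂Q) (mixingClass M) g

/-- The positive integer
`⌈2 B m log (C n B m (B m + sup_{|θ| ≤ m} |κ(θ)|) / δ)⌉`, with `B = |X|_n`; since the order of a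
quadrature rule is a positive integer, values below `1` are replaced by `1`. -/
def quadOrder (μ : Measure ℝ) (p₀ : ℝ → ℝ) (C : ℝ) {n : ℕ} (x : Fin n → ℝ) (m δ : ℝ) : ℕ :=
  max 1 ⌈2 * maxAbs x * m * Real.log (C * n * maxAbs x * m *
    (maxAbs x * m + sSup ((fun θ => |kappa μ p₀ θ|) '' Set.Icc (-m) m)) / δ)⌉₊

/-- For every NPMLE `gHat`, every order-`J` Gaussian quadrature rule `Q` of the empirical measure
and every approximate NPMLE `gJ` computed from `Q`, the supports of `gHat` and `gJ` lie in
`[-m, m]` and the likelihood gap is at most `δ`. -/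
def GapGuarantee (μ : Measure ℝ) (p₀ : ℝ → ℝ) (M : EReal) {n : ℕ} (x : Fin n → ℝ)
    (J : ℕ) (m δ : ℝ) : Prop :=
  ∀ gHat Q gJ : Measure ℝ, IsNPMLE μ p₀ M x gHat → IsGaussQuadrature J (empirical x) Q →
    IsApproxNPMLE μ p₀ M Q gJ →
      gHat.support ∪ gJ.support ⊆ Set.Icc (-m) m ∧
        logLik x (mixDensity μ p₀ gHat) - logLik x (mixDensity μ p₀ gJ) ≤ δ

/-- `Y_n = O_P(r_n)`. -/
def IsBigOP {Ω : Type*} [MeasurableSpace Ω] (P : Measure Ω) (Y : ℕ → Ω → ℝ) (r : ℕ → ℝ) : Prop :=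
  ∀ ε : ℝ, 0 < ε → ∃ K : ℝ, 0 < K ∧
    ∀ᶠ n in atTop, P {ω | K * r n < |Y n ω|} ≤ ENNReal.ofReal ε

/-- The tolerance levels `Δ_n` are positive and of exact order `n^{-γ}`. -/
def IsTolerance (γ : ℝ) (Δ : ℕ → ℝ) : Prop :=
  (∀ n : ℕ, 1 ≤ n → 0 < Δ n) ∧ Δ =Θ[atTop] fun n : ℕ => (n : ℝ) ^ (-γ)

end

end NPMLE

/-! Write B = |X|_n and K = sup |κ| over [-m, m]. If g lives on [-m, m], then l_g is the moment
generating function of the finite measure e^{-κ} dg. It extends to an entire function, and it has no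
zeros where |Im z| ≤ 1/m, because there Re e^{zθ} is positive for every |θ| ≤ m. Hence log l_g is
holomorphic on a Bernstein ellipse around [-B, B] with parameter exp(1/(4Bm)), and its truncated
Chebyshev series of degree 2J - 1 has error at most a constant times Bm (Bm + K) exp(-J/(2Bm)),
uniformly in g (`exists_polynomial_approx_log_likRatio`).

A Gaussian rule integrates such polynomials exactly and has its nodes in [-B, B]
(`IsGaussQuadrature.ae_abs_le`). So n times the quadrature objective is uniformly close to the sum
of the log l_g(X_i), and the maximizer of the former nearly maximizes the latter. The order J_n is
what brings the error below Δ_n (`logLik_gap_le`).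

When M = ∞, the supports are localized by clamping. If BT < κ(±T), convexity of κ shows that moving
all mass outside [-T, T] to the endpoints strictly increases l_g at every |x| ≤ B
(`likRatio_lt_map_clamp`). The growth of κ permits T = A B^{α₁}. The orders of J_n follow from |X|_n
= O_P((log n)^{1/β₀}), because κ and 1/Δ_n enter only through a logarithm (`isBigOP_quadOrder`). -/

namespace NPMLE

/-! ### Chebyshev approximation of functions holomorphic on an ellipse -/

open Complex in
/-- Fourier coefficients of `t ↦ F (B cos t)` are controlled on a larger circle. -/
lemma norm_cos_coeff_le {F : ℂ → ℂ} {B r M' : ℝ} (hr : 1 ≤ r)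
    (hd : ∀ ζ : ℂ, 1 ≤ ‖ζ‖ → ‖ζ‖ ≤ r → DifferentiableAt ℂ F (B / 2 * (ζ + ζ⁻¹)))
    (hb : ∀ ζ : ℂ, ‖ζ‖ = r → ‖F (B / 2 * (ζ + ζ⁻¹))‖ ≤ M') (k : ℕ) :
    ‖∫ t in (0 : ℝ)..2 * Real.pi, exp (-(k * t * I)) * F (B * Real.cos t)‖
      ≤ 2 * Real.pi * (M' * r⁻¹ ^ k) := by
  have hr0 : 0 < r := by linarith
  -- For ζ = e^{it}, the Joukowski map B/2 (ζ + ζ⁻¹) equals B cos t, so up to the factor I the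
  -- coefficient is the integral of G over the unit circle. Moving the contour to radius r through
  -- the annulus gains r^{-k}.
  set G : ℂ → ℂ := fun ζ => (ζ ^ (k + 1))⁻¹ * F (B / 2 * (ζ + ζ⁻¹)) with hG
  have hGd : ∀ ζ : ℂ, 1 ≤ ‖ζ‖ → ‖ζ‖ ≤ r → DifferentiableAt ℂ G ζ := by
    intro ζ h1 h2
    have hζ : ζ ≠ 0 := by rintro rfl; simp at h1; linarith
    refine ((differentiableAt_id.pow _).inv (pow_ne_zero _ hζ)).mul ?_
    exact DifferentiableAt.comp (g := F) ζ (hd ζ h1 h2)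
      ((differentiableAt_id.add (differentiableAt_id.inv hζ)).const_mul _)
  have h1 : (∮ z in C(0, r), G z) = ∮ z in C(0, 1), G z := by
    refine circleIntegral_eq_of_differentiable_on_annulus_off_countable one_pos hr
      Set.countable_empty ?_ ?_
    · intro z hz
      simp only [Set.mem_sdiff, Metric.mem_closedBall, dist_zero_right, Metric.mem_ball, not_lt] at hz
      exact (hGd z hz.2 hz.1).continuousAt.continuousWithinAt
    · intro z hz
      simp only [Set.sdiff_empty, Set.mem_sdiff, Metric.mem_ball, dist_zero_right,
        Metric.mem_closedBall, not_le] at hz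
      exact hGd z hz.2.le hz.1.le
  have h2 : ‖∮ z in C(0, r), G z‖ ≤ 2 * Real.pi * r * ((r ^ (k + 1))⁻¹ * M') := by
    refine circleIntegral.norm_integral_le_of_norm_le_const hr0.le ?_
    intro z hz
    rw [mem_sphere_zero_iff_norm] at hz
    rw [hG]; simp only [norm_mul, norm_inv, norm_pow, hz]
    gcongr
    exact hb z hz
  have h3 : (∮ z in C(0, 1), G z)
      = I * ∫ t in (0 : ℝ)..2 * Real.pi, exp (-(k * t * I)) * F (B * Real.cos t) := by
    rw [circleIntegral, ← intervalIntegral.integral_const_mul]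
    refine intervalIntegral.integral_congr fun t _ => ?_
    simp only [deriv_circleMap, circleMap_zero, ofReal_one, one_mul, smul_eq_mul, hG]
    have e1 : (B : ℂ) / 2 * (exp (t * I) + (exp (t * I))⁻¹) = B * Real.cos t := by
      rw [← exp_neg, ofReal_cos, Complex.cos]; ring_nf
    rw [e1, ← exp_nat_mul, ← exp_neg]
    have e2 : exp (-(((k + 1 : ℕ) : ℂ) * (t * I))) = exp (-(k * t * I)) * (exp (t * I))⁻¹ := by
      rw [← exp_neg, ← exp_add]; push_cast; ring_nf
    rw [e2]
    field_simp [exp_ne_zero]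
  have h4 : ‖∮ z in C(0, 1), G z‖
      = ‖∫ t in (0 : ℝ)..2 * Real.pi, exp (-(k * t * I)) * F (B * Real.cos t)‖ := by
    rw [h3, norm_mul, norm_I, one_mul]
  rw [← h4, ← h1]
  refine h2.trans (le_of_eq ?_)
  rw [pow_succ, inv_pow]
  field_simp

open Complex in
/-- A function holomorphic on a Bernstein ellipse has a geometrically convergent cosine series. -/
lemma exists_hasSum_cos {F : ℂ → ℂ} {B r M' : ℝ} (hr : 1 < r)
    (hd : ∀ ζ : ℂ, 1 ≤ ‖ζ‖ → ‖ζ‖ ≤ r → DifferentiableAt ℂ F (B / 2 * (ζ + ζ⁻¹)))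
    (hb : ∀ ζ : ℂ, ‖ζ‖ = r → ‖F (B / 2 * (ζ + ζ⁻¹))‖ ≤ M') :
    ∃ c : ℕ → ℂ, (∀ k, ‖c k‖ ≤ M' * r⁻¹ ^ k) ∧ ∀ t : ℝ,
      HasSum (fun k : ℕ => 2 * c k * Real.cos (k * t)) (F (B * Real.cos t) + c 0) := by
  have : Fact (0 < 2 * Real.pi) := ⟨Real.two_pi_pos⟩
  have hFc : ∀ t : ℝ, ContinuousAt F (B * Real.cos t) := by
    intro t
    have := (hd (exp (t * I)) (by simp [norm_exp_ofReal_mul_I])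
      (by simp [norm_exp_ofReal_mul_I, hr.le])).continuousAt
    have e1 : (B : ℂ) / 2 * (exp (t * I) + (exp (t * I))⁻¹) = B * Real.cos t := by
      rw [← exp_neg, ofReal_cos, Complex.cos]; ring_nf
    rwa [e1] at this
  have hexp : ∀ t : ℝ, ((AddCircle.toCircle (t : AddCircle (2 * Real.pi)) : Circle) : ℂ).re
      = Real.cos t := by
    intro t
    rw [AddCircle.toCircle_apply_mk, Circle.coe_exp, div_self Real.two_pi_pos.ne', one_mul,
      exp_ofReal_mul_I_re]
  let φ : C(AddCircle (2 * Real.pi), ℂ) :=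
    ⟨fun x => F (B * (((AddCircle.toCircle x : Circle) : ℂ).re : ℝ)), by
      rw [continuous_iff_continuousAt]
      intro x
      induction x using QuotientAddGroup.induction_on with
      | H t =>
        refine ContinuousAt.comp (g := F) (f := fun x : AddCircle (2 * Real.pi) =>
          (B : ℂ) * (((AddCircle.toCircle x : Circle) : ℂ).re : ℝ)) ?_ ?_
        · have := hFc t
          rw [← hexp t] at this
          exact this
        · have : Continuous fun x : AddCircle (2 * Real.pi) =>
            (B : ℂ) * (((AddCircle.toCircle x : Circle) : ℂ).re : ℝ) := by
            have := AddCircle.continuous_toCircle (T := 2 * Real.pi)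
            fun_prop
          exact this.continuousAt⟩
  have hφ : ∀ t : ℝ, φ (t : AddCircle (2 * Real.pi)) = F (B * Real.cos t) := by
    intro t
    change F (B * (((AddCircle.toCircle (t : AddCircle (2 * Real.pi)) : Circle) : ℂ).re : ℝ)) = _
    rw [hexp]
  have hfou : ∀ (n : ℤ) (t : ℝ), fourier n (t : AddCircle (2 * Real.pi)) = exp (n * t * I) := by
    intro n t
    rw [fourier_coe_apply]
    congr 1
    have : (Real.pi : ℂ) ≠ 0 := ofReal_ne_zero.2 Real.pi_ne_zero
    push_cast
    field_simp
  have hcoef : ∀ n : ℤ, fourierCoeff φ n = (1 / (2 * Real.pi)) •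
      ∫ t in (0 : ℝ)..2 * Real.pi, exp (-(n * t * I)) * F (B * Real.cos t) := by
    intro n
    rw [fourierCoeff_eq_intervalIntegral _ n 0, zero_add]
    congr 1
    refine intervalIntegral.integral_congr fun t _ => ?_
    simp only [smul_eq_mul]
    rw [hφ, hfou]; push_cast; ring_nf
  -- The substitution t ↦ 2π - t fixes the cosine and exchanges the frequencies n and -n.
  have hsymm : ∀ n : ℤ, fourierCoeff φ (-n) = fourierCoeff φ n := by
    intro n
    rw [hcoef, hcoef]
    congr 1
    have h := intervalIntegral.integral_comp_sub_left (a := 0) (b := 2 * Real.pi)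
      (fun t : ℝ => exp (-(n * t * I)) * F (B * Real.cos t)) (2 * Real.pi)
    rw [sub_self, sub_zero] at h
    rw [← h]
    refine intervalIntegral.integral_congr fun t _ => ?_
    rw [Real.cos_two_pi_sub]
    congr 1
    rw [exp_eq_exp_iff_exists_int]
    refine ⟨n, ?_⟩
    push_cast; ring
  have hle : ∀ k : ℕ, ‖fourierCoeff φ k‖ ≤ M' * r⁻¹ ^ k := by
    intro k
    have := norm_cos_coeff_le hr.le hd hb k
    rw [hcoef, norm_smul, Real.norm_of_nonneg (by positivity), Int.cast_natCast]
    calc _ ≤ 1 / (2 * Real.pi) * (2 * Real.pi * (M' * r⁻¹ ^ k)) := by gcongr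
      _ = _ := by have := Real.pi_pos; field_simp
  have hri : r⁻¹ < 1 := inv_lt_one_of_one_lt₀ hr
  have hsum : Summable fun k : ℕ => fourierCoeff φ k :=
    Summable.of_norm_bounded ((summable_geometric_of_lt_one (by positivity) hri).mul_left M') hle
  have hsumZ : Summable (fourierCoeff φ) := by
    refine Summable.of_nat_of_neg hsum ?_
    simpa only [hsymm] using hsum
  refine ⟨fun k => fourierCoeff φ k, hle, fun t => ?_⟩
  have key := has_pointwise_sum_fourier_series_of_summable hsumZ (t : AddCircle (2 * Real.pi))
  -- Pairing k with -k counts k = 0 twice, whence the extra `c 0` in the sum.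
  have := key.nat_add_neg
  rw [hφ] at this
  convert this using 2 with k
  · rw [hsymm, hfou, hfou, smul_eq_mul, smul_eq_mul, ofReal_cos, Complex.cos]
    push_cast
    ring_nf
  · simp

/-- Geometric polynomial approximation on `[-B, B]` of functions holomorphic on a Bernstein
ellipse. -/
lemma exists_polynomial_approx {F : ℂ → ℂ} {B r M' : ℝ} (hB : 0 < B) (hr : 1 < r)
    (hd : ∀ ζ : ℂ, 1 ≤ ‖ζ‖ → ‖ζ‖ ≤ r → DifferentiableAt ℂ F (B / 2 * (ζ + ζ⁻¹)))
    (hb : ∀ ζ : ℂ, ‖ζ‖ = r → ‖F (B / 2 * (ζ + ζ⁻¹))‖ ≤ M') (N : ℕ) :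
    ∃ q : Polynomial ℝ, q.natDegree ≤ N ∧ ∀ x ∈ Set.Icc (-B) B,
      |(F x).re - q.eval x| ≤ 2 * M' * r⁻¹ ^ (N + 1) / (1 - r⁻¹) := by
  obtain ⟨c, hc, hsum⟩ := exists_hasSum_cos hr hd hb
  have hri : r⁻¹ < 1 := inv_lt_one_of_one_lt₀ hr
  have hr0 : 0 < r := by linarith
  -- Since T_k(cos t) = cos(kt), the cosine series is a Chebyshev series in x / B. The witness is
  -- its truncation, with the doubled constant term corrected.
  refine ⟨(∑ k ∈ Finset.range (N + 1), Polynomial.C (2 * (c k).re) *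
    (Polynomial.Chebyshev.T ℝ k).comp (Polynomial.C B⁻¹ * Polynomial.X)) -
      Polynomial.C (c 0).re, ?_, ?_⟩
  · refine (Polynomial.natDegree_sub_le _ _).trans (max_le ?_ (by simp))
    refine Polynomial.natDegree_sum_le_of_forall_le _ _ fun k hk => ?_
    refine (Polynomial.natDegree_C_mul_le _ _).trans ?_
    refine Polynomial.natDegree_comp_le.trans ?_
    rw [Polynomial.Chebyshev.natDegree_T, Int.natAbs_natCast]
    have := (Polynomial.natDegree_C_mul_le B⁻¹ Polynomial.X).trans Polynomial.natDegree_X_le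
    have hk := Finset.mem_range_succ_iff.1 hk
    nlinarith
  · intro x hx
    obtain ⟨t, rfl⟩ : ∃ t, x = B * Real.cos t := by
      refine ⟨Real.arccos (x / B), ?_⟩
      rw [Real.cos_arccos]
      · field_simp
      · rw [le_div_iff₀ hB]; linarith [hx.1]
      · rw [div_le_iff₀ hB]; linarith [hx.2]
    have h1 := Complex.hasSum_re (hsum t)
    have hre : ∀ k : ℕ, (2 * c k * (Real.cos (k * t) : ℂ)).re = 2 * (c k).re * Real.cos (k * t) := by
      intro k
      rw [Complex.re_mul_ofReal]
      simp
    have hev : ((∑ k ∈ Finset.range (N + 1), Polynomial.C (2 * (c k).re) *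
        (Polynomial.Chebyshev.T ℝ k).comp (Polynomial.C B⁻¹ * Polynomial.X)) -
        Polynomial.C (c 0).re).eval (B * Real.cos t)
        = ∑ k ∈ Finset.range (N + 1), 2 * (c k).re * Real.cos (k * t) - (c 0).re := by
      simp only [Polynomial.eval_sub, Polynomial.eval_finsetSum, Polynomial.eval_mul,
        Polynomial.eval_C, Polynomial.eval_comp, Polynomial.eval_X]
      congr 1
      refine Finset.sum_congr rfl fun k _ => ?_
      rw [inv_mul_cancel_left₀ hB.ne', Polynomial.Chebyshev.T_real_cos]
      simp
    simp only [hre] at h1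
    rw [Complex.add_re] at h1
    have h2 := (hasSum_nat_add_iff' (N + 1)).2 h1
    rw [hev]
    have e : (F (↑(B * Real.cos t))).re - (∑ k ∈ Finset.range (N + 1),
        2 * (c k).re * Real.cos (k * t) - (c 0).re) = (F (B * Real.cos t)).re + (c 0).re -
        ∑ k ∈ Finset.range (N + 1), 2 * (c k).re * Real.cos (k * t) := by
      push_cast; ring
    rw [e, ← h2.tsum_eq, ← Real.norm_eq_abs]
    have hg : HasSum (fun i : ℕ => 2 * M' * r⁻¹ ^ (N + 1) * r⁻¹ ^ i)
        (2 * M' * r⁻¹ ^ (N + 1) * (1 - r⁻¹)⁻¹) :=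
      (hasSum_geometric_of_lt_one (by positivity) hri).mul_left _
    rw [div_eq_mul_inv]
    refine tsum_of_norm_bounded hg fun i => ?_
    have h3 : |(c (i + (N + 1))).re| ≤ M' * r⁻¹ ^ (i + (N + 1)) :=
      (Complex.abs_re_le_norm _).trans (hc _)
    rw [Real.norm_eq_abs, abs_mul, abs_mul, abs_two]
    calc _ ≤ 2 * |(c (i + (N + 1))).re| * 1 := by
          gcongr; exact Real.abs_cos_le_one _
      _ ≤ 2 * (M' * r⁻¹ ^ (i + (N + 1))) * 1 := by gcongr
      _ = _ := by rw [pow_add]; ring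

/-! ### Quadrature rules -/

lemma integrable_of_finset_support {Q : Measure ℝ} [IsFiniteMeasure Q] {s : Finset ℝ}
    (hs : Q ((s : Set ℝ)ᶜ) = 0) (f : ℝ → ℝ) : Integrable f Q := by
  have h : Q.restrict s = Q := Measure.restrict_eq_self_of_ae_mem hs
  rw [← h]
  exact IntegrableOn.finset

lemma integral_eq_sum_of_finset_support {Q : Measure ℝ} [IsFiniteMeasure Q] {s : Finset ℝ}
    (hs : Q ((s : Set ℝ)ᶜ) = 0) (f : ℝ → ℝ) : ∫ x, f x ∂Q = ∑ x ∈ s, Q.real {x} * f x := by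
  have h : Q.restrict s = Q := Measure.restrict_eq_self_of_ae_mem hs
  have hi : IntegrableOn f s Q := (integrable_of_finset_support hs f).integrableOn
  simpa only [h, smul_eq_mul] using setIntegral_finset s hi

lemma integral_empirical {n : ℕ} (x : Fin n → ℝ) (f : ℝ → ℝ) :
    ∫ y, f y ∂(empirical x) = (n : ℝ)⁻¹ * ∑ i, f (x i) := by
  rw [empirical, integral_smul_measure, integral_finsetSum_measure]
  · simp
  · intro i _
    exact integrable_dirac (by simp)

lemma abs_le_maxAbs {n : ℕ} (x : Fin n → ℝ) (i : Fin n) : |x i| ≤ maxAbs x :=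
  le_ciSup (f := fun i => |x i|) (Set.finite_range _).bddAbove i

lemma maxAbs_nonneg {n : ℕ} (x : Fin n → ℝ) : 0 ≤ maxAbs x :=
  Real.iSup_nonneg fun _ => abs_nonneg _

namespace IsGaussQuadrature

/-- Finite support makes every function integrable, so logarithms of likelihood ratios need no
separate check under Q. -/
lemma integrable {J : ℕ} {ν Q : Measure ℝ} (hQ : IsGaussQuadrature J ν Q) (f : ℝ → ℝ) :
    Integrable f Q := by
  have := hQ.prob
  obtain ⟨s, -, hs⟩ := hQ.finite_support
  exact integrable_of_finset_support hs f

variable {J n : ℕ} {x : Fin n → ℝ} {Q : Measure ℝ}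

lemma integral_polynomial (hQ : IsGaussQuadrature J (empirical x) Q) {q : Polynomial ℝ}
    (hq : q.natDegree ≤ 2 * J - 1) :
    ∫ y, q.eval y ∂Q = (n : ℝ)⁻¹ * ∑ i, q.eval (x i) := by
  rw [← integral_empirical x (fun y => q.eval y)]
  have hemp : ∀ f : ℝ → ℝ, Integrable f (empirical x) := by
    intro f
    rcases Nat.eq_zero_or_pos n with rfl | hn
    · simp [empirical]
    · refine Integrable.smul_measure ?_ (by simp [hn.ne'])
      exact integrable_finsetSum_measure.2 fun i _ => integrable_dirac (by simp)
  simp only [Polynomial.eval_eq_sum_range]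
  rw [integral_finsetSum _ fun i _ => hQ.integrable _, integral_finsetSum _ fun i _ => hemp _]
  refine Finset.sum_congr rfl fun k hk => ?_
  rw [integral_const_mul, integral_const_mul, hQ.moments k]
  have := Finset.mem_range_succ_iff.1 hk
  omega

/-- The nodes of a Gaussian quadrature rule lie in the convex hull of the data. -/
lemma ae_abs_le (hQ : IsGaussQuadrature J (empirical x) Q) : ∀ᵐ y ∂Q, |y| ≤ maxAbs x := by
  have := hQ.prob
  obtain ⟨s, hcard, hs⟩ := hQ.finite_support
  have key : ∀ y ∈ s, maxAbs x < |y| → Q {y} = 0 := by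
    intro y hy hlt
    obtain ⟨ε, hε, hεy⟩ : ∃ ε : ℝ, |ε| = 1 ∧ ε * y = |y| := by
      rcases le_total 0 y with h | h
      · exact ⟨1, by simp, by rw [abs_of_nonneg h, one_mul]⟩
      · exact ⟨-1, by simp, by rw [abs_of_nonpos h]; ring⟩
    -- Test polynomial against a node y outside the data range: it vanishes at all other nodes, is
    -- nonnegative on the data and negative at y. Its degree is at most 2(J - 1) + 1, so its
    -- Q-integral is exact, hence nonnegative, which forces Q {y} = 0.
    set q : Polynomial ℝ := (∏ j ∈ s.erase y, (Polynomial.X - Polynomial.C j) ^ 2) *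
      (Polynomial.C (maxAbs x) - Polynomial.C ε * Polynomial.X) with hq
    have hdeg : q.natDegree ≤ 2 * J - 1 := by
      have h1 : (∏ j ∈ s.erase y, (Polynomial.X - Polynomial.C j) ^ 2 : Polynomial ℝ).natDegree
          ≤ 2 * (s.card - 1) := by
        refine (Polynomial.natDegree_prod_le _ _).trans ?_
        refine (Finset.sum_le_card_nsmul _ _ 2 fun j _ => ?_).trans ?_
        · refine Polynomial.natDegree_pow_le.trans ?_
          rw [Polynomial.natDegree_X_sub_C]
        · rw [Finset.card_erase_of_mem hy, smul_eq_mul, mul_comm]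
      have h2 : (Polynomial.C (maxAbs x) - Polynomial.C ε * Polynomial.X).natDegree ≤ 1 := by
        refine (Polynomial.natDegree_sub_le _ _).trans (max_le (by simp) ?_)
        exact (Polynomial.natDegree_C_mul_le _ _).trans Polynomial.natDegree_X_le
      have h3 : 0 < s.card := Finset.card_pos.2 ⟨y, hy⟩
      have h4 := Polynomial.natDegree_mul_le
        (p := ∏ j ∈ s.erase y, (Polynomial.X - Polynomial.C j : Polynomial ℝ) ^ 2)
        (q := Polynomial.C (maxAbs x) - Polynomial.C ε * Polynomial.X)
      rw [hq]
      omega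
    have hev : ∀ z, q.eval z = (∏ j ∈ s.erase y, (z - j) ^ 2) * (maxAbs x - ε * z) := by
      intro z
      simp [hq, Polynomial.eval_prod]
    have hint := hQ.integral_polynomial hdeg
    have hnonneg : 0 ≤ (n : ℝ)⁻¹ * ∑ i, q.eval (x i) := by
      refine mul_nonneg (by positivity) (Finset.sum_nonneg fun i _ => ?_)
      rw [hev]
      refine mul_nonneg (Finset.prod_nonneg fun j _ => sq_nonneg _) ?_
      have h1 : ε * x i ≤ |x i| := by
        calc ε * x i ≤ |ε * x i| := le_abs_self _
          _ = |x i| := by rw [abs_mul, hε, one_mul]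
      have := abs_le_maxAbs x i
      linarith
    rw [← hint, integral_eq_sum_of_finset_support hs, Finset.sum_eq_single_of_mem y hy] at hnonneg
    · have hneg : q.eval y < 0 := by
        rw [hev, hεy]
        refine mul_neg_of_pos_of_neg (Finset.prod_pos fun j hj => ?_) (by linarith)
        have := sub_ne_zero.2 (Finset.ne_of_mem_erase hj).symm
        positivity
      have h0 : Q.real {y} = 0 := by
        have : 0 ≤ Q.real {y} := measureReal_nonneg
        nlinarith
      exact (measureReal_eq_zero_iff).1 h0
    · intro z hz hzy
      rw [hev, Finset.prod_eq_zero (Finset.mem_erase.2 ⟨hzy, hz⟩) (by simp)]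
      simp
  have hsub : {y | ¬ |y| ≤ maxAbs x} ⊆
      (s : Set ℝ)ᶜ ∪ ⋃ y ∈ s.filter (fun y => maxAbs x < |y|), {y} := by
    intro y hy
    by_cases h : y ∈ s
    · right
      simp only [Set.mem_iUnion]
      exact ⟨y, Finset.mem_filter.2 ⟨h, not_le.1 hy⟩, rfl⟩
    · left; exact h
  refine measure_mono_null hsub (measure_union_null hs ?_)
  refine (measure_biUnion_null_iff (Finset.countable_toSet _)).2 fun y hy => ?_
  have := Finset.mem_filter.1 hy
  exact key y this.1 this.2

/-- Quadrature error bound from polynomial approximation. -/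
lemma abs_integral_sub_le (hQ : IsGaussQuadrature J (empirical x) Q) (hn : 1 ≤ n) {f : ℝ → ℝ}
    {q : Polynomial ℝ} (hq : q.natDegree ≤ 2 * J - 1) {E : ℝ}
    (hE : ∀ y ∈ Set.Icc (-maxAbs x) (maxAbs x), |f y - q.eval y| ≤ E) :
    |∑ i, f (x i) - n * ∫ y, f y ∂Q| ≤ 2 * n * E := by
  have := hQ.prob
  have hn0 : (n : ℝ) ≠ 0 := by positivity
  have h1 : |∑ i, (f (x i) - q.eval (x i))| ≤ n * E := by
    refine (Finset.abs_sum_le_sum_abs _ _).trans ?_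
    refine (Finset.sum_le_card_nsmul _ _ E fun i _ => ?_).trans (by simp)
    exact hE _ (abs_le.1 (abs_le_maxAbs x i))
  have h2 : |∫ y, (f y - q.eval y) ∂Q| ≤ E := by
    rw [← Real.norm_eq_abs]
    refine (norm_integral_le_of_norm_le_const (C := E) ?_).trans (by simp)
    filter_upwards [hQ.ae_abs_le] with y hy
    exact hE y (abs_le.1 hy)
  -- The contributions of q cancel by exactness, which leaves two errors of at most nE each.
  have h3 : ∑ i, f (x i) - n * ∫ y, f y ∂Q
      = ∑ i, (f (x i) - q.eval (x i)) - n * ∫ y, (f y - q.eval y) ∂Q := by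
    rw [integral_sub (hQ.integrable _) (hQ.integrable _), Finset.sum_sub_distrib,
      hQ.integral_polynomial hq]
    field_simp
    ring
  rw [h3]
  refine (abs_sub _ _).trans ?_
  rw [abs_mul, Nat.abs_cast]
  have := mul_le_mul_of_nonneg_left h2 (Nat.cast_nonneg (α := ℝ) n)
  linarith

end IsGaussQuadrature

/-! ### Moment generating functions of compactly supported measures -/

section Compact

variable {ν : Measure ℝ} [IsFiniteMeasure ν] {m K : ℝ}

lemma integrable_exp_mul_of_ae_abs_le (hm : ∀ᵐ θ ∂ν, |θ| ≤ m) (x : ℝ) :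
    Integrable (fun θ => Real.exp (x * id θ)) ν := by
  refine Integrable.of_bound (by fun_prop) (Real.exp (|x| * m)) ?_
  filter_upwards [hm] with θ hθ
  rw [Real.norm_of_nonneg (Real.exp_pos _).le, Real.exp_le_exp]
  calc x * id θ ≤ |x * θ| := le_abs_self _
    _ = |x| * |θ| := abs_mul _ _
    _ ≤ _ := by gcongr

lemma integrableExpSet_eq_univ (hm : ∀ᵐ θ ∂ν, |θ| ≤ m) : integrableExpSet id ν = Set.univ :=
  Set.eq_univ_of_forall fun x => integrable_exp_mul_of_ae_abs_le hm x

lemma differentiableAt_complexMGF_of_ae_abs_le (hm : ∀ᵐ θ ∂ν, |θ| ≤ m) (z : ℂ) :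
    DifferentiableAt ℂ (complexMGF id ν) z := by
  refine (hasDerivAt_complexMGF ?_).differentiableAt
  simp [integrableExpSet_eq_univ hm]

lemma norm_complexMGF_le_of_ae_abs_le (hm : ∀ᵐ θ ∂ν, |θ| ≤ m)
    (hK : ν.real Set.univ ≤ Real.exp K) {R : ℝ} {z : ℂ} (hz : |z.re| ≤ R) :
    ‖complexMGF id ν z‖ ≤ Real.exp (m * R + K) := by
  refine norm_complexMGF_le_mgf.trans ?_
  calc mgf id ν z.re ≤ ∫ _, Real.exp (m * R) ∂ν := by
        refine integral_mono_ae (integrable_exp_mul_of_ae_abs_le hm _) (integrable_const _) ?_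
        filter_upwards [hm] with θ hθ
        rw [Real.exp_le_exp]
        calc z.re * id θ ≤ |z.re * θ| := le_abs_self _
          _ = |θ| * |z.re| := by rw [abs_mul, mul_comm]
          _ ≤ _ := mul_le_mul hθ hz (abs_nonneg _) ((abs_nonneg _).trans hθ)
    _ = Real.exp (m * R) * ν.real Set.univ := by simp [mul_comm]
    _ ≤ _ := by rw [Real.exp_add]; gcongr

/-- For |Im z · θ| ≤ 1 the cosine in Re e^{zθ} is at least 1/2, so positivity of ν prevents
cancellation. This zero-free strip makes the principal logarithm holomorphic. -/
lemma le_re_complexMGF_of_ae_abs_le (hm : ∀ᵐ θ ∂ν, |θ| ≤ m)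
    (hK : Real.exp (-K) ≤ ν.real Set.univ) {R : ℝ} {z : ℂ} (hz : |z.re| ≤ R)
    (hz' : m * |z.im| ≤ 1) :
    Real.exp (-(m * R + K)) / 2 ≤ (complexMGF id ν z).re := by
  have hint : Integrable (fun θ : ℝ => Complex.exp (z * id θ)) ν :=
    integrable_cexp_mul_of_re_mem_integrableExpSet (by fun_prop)
      (by simp [integrableExpSet_eq_univ hm])
  have hre : (complexMGF id ν z).re = ∫ θ, (Complex.exp (z * id θ)).re ∂ν :=
    (integral_re hint).symm
  rw [hre]
  calc Real.exp (-(m * R + K)) / 2 = Real.exp (-(m * R)) / 2 * Real.exp (-K) := by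
        rw [neg_add, Real.exp_add]; ring
    _ ≤ Real.exp (-(m * R)) / 2 * ν.real Set.univ := by gcongr
    _ = ∫ _, Real.exp (-(m * R)) / 2 ∂ν := by simp [mul_comm]
    _ ≤ _ := by
        refine integral_mono_ae (integrable_const _) hint.re ?_
        filter_upwards [hm] with θ hθ
        have h1 : (Complex.exp (z * id θ)).re = Real.exp (z.re * θ) * Real.cos (z.im * θ) := by
          rw [Complex.exp_re]; simp
        change _ ≤ (Complex.exp (z * id θ)).re
        rw [h1]
        have h2 : -(m * R) ≤ z.re * θ := by
          have : |z.re * θ| ≤ m * R := by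
            rw [abs_mul, mul_comm]
            exact mul_le_mul hθ hz (abs_nonneg _) ((abs_nonneg _).trans hθ)
          exact (abs_le.1 this).1
        have h3 : 1 / 2 ≤ Real.cos (z.im * θ) := by
          have h4 := Real.one_sub_sq_div_two_le_cos (x := z.im * θ)
          have h5 : |z.im * θ| ≤ 1 := by
            rw [abs_mul, mul_comm]
            exact (mul_le_mul_of_nonneg_right hθ (abs_nonneg _)).trans hz'
          have h6 := (sq_le_one_iff_abs_le_one _).2 h5
          linarith
        rw [div_eq_mul_one_div]
        exact mul_le_mul (Real.exp_le_exp.2 h2) h3 (by norm_num) (Real.exp_pos _).le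

lemma norm_log_complexMGF_le (hm : ∀ᵐ θ ∂ν, |θ| ≤ m)
    (hK : Real.exp (-K) ≤ ν.real Set.univ) (hK' : ν.real Set.univ ≤ Real.exp K) {R : ℝ} {z : ℂ}
    (hz : |z.re| ≤ R) (hz' : m * |z.im| ≤ 1) :
    ‖Complex.log (complexMGF id ν z)‖ ≤ m * R + K + 4 := by
  have h1 := norm_complexMGF_le_of_ae_abs_le hm hK' hz
  have h2 := (le_re_complexMGF_of_ae_abs_le hm hK hz hz').trans (Complex.re_le_norm _)
  have hpos : 0 < ‖complexMGF id ν z‖ := lt_of_lt_of_le (by positivity) h2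
  have h3 : |Real.log ‖complexMGF id ν z‖| ≤ m * R + K + Real.log 2 := by
    have h4 := Real.log_le_log hpos h1
    have h5 := Real.log_le_log (by positivity) h2
    rw [Real.log_exp] at h4
    rw [Real.log_div (Real.exp_pos _).ne' two_ne_zero, Real.log_exp] at h5
    have := Real.log_pos one_lt_two
    rw [abs_le]
    constructor <;> linarith
  -- The constant 4 covers log 2 from the lower bound on the modulus and π from the argument.
  have h6 := Complex.norm_le_abs_re_add_abs_im (Complex.log (complexMGF id ν z))
  rw [Complex.log_re, Complex.log_im] at h6
  have h7 := Complex.abs_arg_le_pi (complexMGF id ν z)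
  have h8 := Real.pi_lt_d2
  have h9 := Real.log_two_lt_d9
  linarith

/-- The cumulant generating function of a compactly supported measure is approximated by
polynomials on `[-B, B]` at a geometric rate. -/
lemma exists_polynomial_approx_cgf (hm : ∀ᵐ θ ∂ν, |θ| ≤ m) (hm0 : 0 < m) (hK0 : 0 ≤ K)
    (hK : Real.exp (-K) ≤ ν.real Set.univ) (hK' : ν.real Set.univ ≤ Real.exp K) {B : ℝ}
    (hB : 0 < B) (hBm : 1 ≤ B * m) {J : ℕ} (hJ : 1 ≤ J) :
    ∃ q : Polynomial ℝ, q.natDegree ≤ 2 * J - 1 ∧ ∀ x ∈ Set.Icc (-B) B,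
      |cgf id ν x - q.eval x| ≤
        96 * (B * m) * (B * m + K) * Real.exp (-(J / (2 * (B * m)))) := by
  -- With r = e^s, m times the imaginary part on the ellipse is at most m (B/2)(4s) = 1/2, inside
  -- the zero-free strip, while r^{-2J} = exp(-J/(2Bm)). The bound Bm ≥ 1 keeps s small enough to
  -- linearize the exponential.
  set s : ℝ := 1 / (4 * (B * m)) with hs
  have hs0 : 0 < s := by positivity
  have hs4 : s ≤ 1 / 4 := by
    rw [hs]; exact one_div_le_one_div_of_le (by norm_num) (by linarith)
  set r := Real.exp s with hr
  have hr1 : 1 < r := Real.one_lt_exp_iff.2 hs0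
  have hr0 : 0 < r := by positivity
  have hr2 : r ≤ 1 + 2 * s := by
    have := Real.abs_exp_sub_one_le (x := s) (by rw [abs_of_pos hs0]; linarith)
    rw [abs_of_pos hs0] at this
    have := (abs_le.1 this).2
    linarith
  have hrr : r ^ 2 - 1 ≤ 4 * s := by
    have := Real.abs_exp_sub_one_le (x := 2 * s) (by rw [abs_of_pos (by linarith)]; linarith)
    rw [abs_of_pos (by linarith : 0 < 2 * s), two_mul, Real.exp_add, ← sq] at this
    have := (abs_le.1 this).2
    linarith
  have hgeo : ∀ ζ : ℂ, 1 ≤ ‖ζ‖ → ‖ζ‖ ≤ r →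
      |((B : ℂ) / 2 * (ζ + ζ⁻¹)).re| ≤ 2 * B ∧ m * |((B : ℂ) / 2 * (ζ + ζ⁻¹)).im| ≤ 1 := by
    intro ζ h1 h2
    have hcast : ((B : ℂ) / 2) = ((B / 2 : ℝ) : ℂ) := by push_cast; rfl
    rw [hcast, Complex.re_ofReal_mul, Complex.im_ofReal_mul, abs_mul, abs_mul,
      abs_of_pos (by positivity : 0 < B / 2)]
    have hinv : ‖ζ⁻¹‖ ≤ 1 := by rw [norm_inv]; exact inv_le_one_of_one_le₀ h1
    constructor
    · have : |(ζ + ζ⁻¹).re| ≤ 4 := by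
        refine (Complex.abs_re_le_norm _).trans ((norm_add_le _ _).trans ?_)
        linarith
      nlinarith
    · have h3 : (ζ + ζ⁻¹).im = ζ.im * (1 - (‖ζ‖ ^ 2)⁻¹) := by
        rw [Complex.add_im, Complex.inv_im, Complex.normSq_eq_norm_sq]; ring
      have h4 : (‖ζ‖ ^ 2)⁻¹ ≤ 1 := inv_le_one_of_one_le₀ (one_le_pow₀ h1)
      have h5 : |(ζ + ζ⁻¹).im| ≤ r ^ 2 - 1 := by
        rw [h3, abs_mul, abs_of_nonneg (sub_nonneg.2 h4)]
        calc |ζ.im| * (1 - (‖ζ‖ ^ 2)⁻¹) ≤ ‖ζ‖ * (1 - (‖ζ‖ ^ 2)⁻¹) := by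
              gcongr
              · exact Complex.abs_im_le_norm _
          _ ≤ ‖ζ‖ ^ 2 * (1 - (‖ζ‖ ^ 2)⁻¹) := by
              gcongr
              · exact le_self_pow₀ h1 two_ne_zero
          _ = ‖ζ‖ ^ 2 - 1 := by
              have : ‖ζ‖ ≠ 0 := by positivity
              field_simp
          _ ≤ r ^ 2 - 1 := by gcongr
      calc m * (B / 2 * |(ζ + ζ⁻¹).im|) ≤ m * (B / 2 * (4 * s)) := by gcongr; exact h5.trans hrr
        _ = 1 / 2 := by rw [hs]; field_simp
        _ ≤ 1 := by norm_num
  have hpos : ∀ z : ℂ, |z.re| ≤ 2 * B → m * |z.im| ≤ 1 → 0 < (complexMGF id ν z).re :=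
    fun z h1 h2 => lt_of_lt_of_le (by positivity) (le_re_complexMGF_of_ae_abs_le hm hK h1 h2)
  obtain ⟨q, hq, hqE⟩ := exists_polynomial_approx (F := fun z => Complex.log (complexMGF id ν z))
    (M' := m * (2 * B) + K + 4) hB hr1
    (fun ζ h1 h2 => (differentiableAt_complexMGF_of_ae_abs_le hm _).clog
      (Or.inl (hpos _ (hgeo ζ h1 h2).1 (hgeo ζ h1 h2).2)))
    (fun ζ h => norm_log_complexMGF_le hm hK hK' (hgeo ζ (h ▸ hr1.le) h.le).1
      (hgeo ζ (h ▸ hr1.le) h.le).2) (2 * J - 1)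
  refine ⟨q, hq, fun x hx => ?_⟩
  have h1 := hqE x hx
  rw [Complex.log_re, complexMGF_ofReal, Complex.norm_real, Real.norm_of_nonneg mgf_nonneg] at h1
  refine h1.trans ?_
  rw [show 2 * J - 1 + 1 = 2 * J by omega]
  have h2 : r⁻¹ ^ (2 * J) = Real.exp (-(J / (2 * (B * m)))) := by
    rw [hr, ← Real.exp_neg, ← Real.exp_nat_mul]
    congr 1
    rw [hs]; push_cast; field_simp; ring
  -- The denominator of the geometric tail costs a factor of order Bm.
  have h3 : s / 2 ≤ 1 - r⁻¹ := by
    have h4 : 1 + s ≤ r := by have := Real.add_one_le_exp s; linarith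
    have h5 : r⁻¹ ≤ (1 + s)⁻¹ := inv_anti₀ (by linarith) h4
    have h6 : (1 + s)⁻¹ ≤ 1 - s / 2 := by
      rw [inv_le_iff_one_le_mul₀ (by linarith)]; nlinarith
    linarith
  rw [h2]
  calc 2 * (m * (2 * B) + K + 4) * Real.exp (-(J / (2 * (B * m)))) / (1 - r⁻¹)
      ≤ 2 * (m * (2 * B) + K + 4) * Real.exp (-(J / (2 * (B * m)))) / (s / 2) := by
        gcongr
    _ = 16 * (B * m) * (2 * (B * m) + K + 4) * Real.exp (-(J / (2 * (B * m)))) := by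
        rw [hs]; field_simp; ring
    -- Bm ≥ 1 absorbs the additive 4, and 96 = 16 · 6.
    _ ≤ 16 * (B * m) * (6 * (B * m + K)) * Real.exp (-(J / (2 * (B * m)))) := by
        gcongr; linarith
    _ = _ := by ring

end Compact

/-! ### The exponential family -/

section Family

variable {μ : Measure ℝ} {p₀ : ℝ → ℝ} {m K : ℝ}

lemma IsBaseDensity.isProbabilityMeasure (hp : IsBaseDensity μ p₀) :
    IsProbabilityMeasure (baseMeasure μ p₀) :=
  ⟨by rw [baseMeasure, withDensity_apply _ MeasurableSet.univ, Measure.restrict_univ,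
    hp.lintegral_eq_one]⟩

lemma measurable_kappa (hp : IsBaseDensity μ p₀) : Measurable (kappa μ p₀) := by
  have := hp.isProbabilityMeasure
  refine Real.measurable_log.comp ?_
  have : StronglyMeasurable fun p : ℝ × ℝ => Real.exp (p.1 * id p.2) :=
    (by fun_prop : Measurable _).stronglyMeasurable
  exact (this.integral_prod_right (ν := baseMeasure μ p₀)).measurable

/-- The interval may reach the boundary of Θ, where interior smoothness of κ says nothing. Instead
the moment generating function is squeezed between ∫ e^{-m|x|} > 0 and the sum of its values at m
and -m. -/
lemma exists_abs_kappa_le (hp : IsBaseDensity μ p₀)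
    (hm : Set.Icc (-m) m ⊆ canonicalSpace μ p₀) :
    ∃ K, ∀ θ ∈ Set.Icc (-m) m, |kappa μ p₀ θ| ≤ K := by
  have := hp.isProbabilityMeasure
  rcases lt_or_ge m 0 with hneg | hm0
  · exact ⟨0, fun θ hθ => absurd (hθ.1.trans hθ.2) (by linarith)⟩
  set P := baseMeasure μ p₀
  have i1 : Integrable (fun x => Real.exp (m * id x)) P := hm ⟨by linarith, le_rfl⟩
  have i2 : Integrable (fun x => Real.exp (-m * id x)) P := hm ⟨le_rfl, by linarith⟩
  have hlow : Integrable (fun x : ℝ => Real.exp (-(m * |x|))) P := by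
    refine Integrable.of_bound (by fun_prop) 1 (Eventually.of_forall fun x => ?_)
    rw [Real.norm_of_nonneg (Real.exp_pos _).le, Real.exp_le_one_iff]
    have := mul_nonneg hm0 (abs_nonneg x)
    linarith
  set c := ∫ x : ℝ, Real.exp (-(m * |x|)) ∂P
  have hc : 0 < c := integral_exp_pos hlow
  refine ⟨max |Real.log c| |Real.log (mgf id P m + mgf id P (-m))|, fun θ hθ => ?_⟩
  have iθ : Integrable (fun x => Real.exp (θ * id x)) P := hm hθ
  have hθm : |θ| ≤ m := abs_le.2 hθ
  have h1 : c ≤ mgf id P θ := by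
    refine integral_mono hlow iθ fun x => ?_
    simp only [id, Real.exp_le_exp]
    have : |θ * x| ≤ m * |x| := by rw [abs_mul]; gcongr
    linarith [neg_abs_le (θ * x)]
  have h2 : mgf id P θ ≤ mgf id P m + mgf id P (-m) := by
    rw [mgf, mgf, mgf, ← integral_add i1 i2]
    refine integral_mono iθ (i1.add i2) fun x => ?_
    simp only [id]
    have : |θ * x| ≤ |m * x| := by rw [abs_mul, abs_mul, abs_of_nonneg hm0]; gcongr
    rcases le_total 0 (m * x) with h | h
    · rw [abs_of_nonneg h] at this
      have := Real.exp_le_exp.2 ((le_abs_self _).trans this)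
      have := Real.exp_pos (-m * x)
      linarith
    · rw [abs_of_nonpos h, ← neg_mul] at this
      have := Real.exp_le_exp.2 ((le_abs_self _).trans this)
      have := Real.exp_pos (m * x)
      linarith
  have h3 := Real.log_le_log hc h1
  have h4 := Real.log_le_log (hc.trans_le h1) h2
  change |Real.log (mgf id P θ)| ≤ _
  rw [abs_le]
  constructor
  · have := neg_abs_le (Real.log c)
    have := le_max_left |Real.log c| |Real.log (mgf id P m + mgf id P (-m))|
    linarith
  · exact h4.trans ((le_abs_self _).trans (le_max_right _ _))

/-- The supremum of `|κ|` over `[-m, m]`. -/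
noncomputable def supKappa (μ : Measure ℝ) (p₀ : ℝ → ℝ) (m : ℝ) : ℝ :=
  sSup ((fun θ => |kappa μ p₀ θ|) '' Set.Icc (-m) m)

lemma supKappa_nonneg : 0 ≤ supKappa μ p₀ m :=
  Real.sSup_nonneg (by rintro _ ⟨θ, -, rfl⟩; exact abs_nonneg _)

lemma abs_kappa_le_supKappa (hp : IsBaseDensity μ p₀)
    (hm : Set.Icc (-m) m ⊆ canonicalSpace μ p₀) {θ : ℝ} (hθ : |θ| ≤ m) :
    |kappa μ p₀ θ| ≤ supKappa μ p₀ m := by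
  obtain ⟨K, hK⟩ := exists_abs_kappa_le hp hm
  exact le_csSup ⟨K, by rintro _ ⟨θ, hθ, rfl⟩; exact hK θ hθ⟩ ⟨θ, abs_le.1 hθ, rfl⟩

lemma ae_abs_le_of_support_subset {g : Measure ℝ} (hg : g.support ⊆ Set.Icc (-m) m) :
    ∀ᵐ θ ∂g, |θ| ≤ m := by
  filter_upwards [Measure.support_mem_ae (μ := g)] with θ hθ
  exact abs_le.2 (hg hθ)

lemma mixDensity_eq (g : Measure ℝ) (x : ℝ) :
    mixDensity μ p₀ g x = likRatio μ p₀ g x * p₀ x :=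
  integral_mul_const _ _

variable {g : Measure ℝ} [IsProbabilityMeasure g]

lemma integrable_exp_sub_kappa (hp : IsBaseDensity μ p₀)
    (hm : Set.Icc (-m) m ⊆ canonicalSpace μ p₀) (hg : ∀ᵐ θ ∂g, |θ| ≤ m) (x : ℝ) :
    Integrable (fun θ => Real.exp (θ * x - kappa μ p₀ θ)) g := by
  have := measurable_kappa hp
  refine Integrable.of_bound (by fun_prop) (Real.exp (m * |x| + supKappa μ p₀ m)) ?_
  filter_upwards [hg] with θ hθ
  rw [Real.norm_of_nonneg (Real.exp_pos _).le, Real.exp_le_exp]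
  have h1 := neg_abs_le (kappa μ p₀ θ)
  have h2 := abs_kappa_le_supKappa hp hm hθ
  have h3 : θ * x ≤ m * |x| := by
    refine (le_abs_self _).trans ?_
    rw [abs_mul]; gcongr
  linarith

lemma likRatio_pos (hp : IsBaseDensity μ p₀)
    (hm : Set.Icc (-m) m ⊆ canonicalSpace μ p₀) (hg : ∀ᵐ θ ∂g, |θ| ≤ m) (x : ℝ) :
    0 < likRatio μ p₀ g x :=
  integral_exp_pos (integrable_exp_sub_kappa hp hm hg x)

/-- l_g is the moment generating function of e^{-κ} dg, whose mass lies between e^{-K} and e^K with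
K = sup |κ|. The error bound therefore does not depend on g. -/
lemma exists_polynomial_approx_log_likRatio (hp : IsBaseDensity μ p₀)
    (hm : Set.Icc (-m) m ⊆ canonicalSpace μ p₀) (hg : ∀ᵐ θ ∂g, |θ| ≤ m) (hm0 : 0 < m) {B : ℝ}
    (hB : 0 < B) (hBm : 1 ≤ B * m) {J : ℕ} (hJ : 1 ≤ J) :
    ∃ q : Polynomial ℝ, q.natDegree ≤ 2 * J - 1 ∧ ∀ x ∈ Set.Icc (-B) B,
      |Real.log (likRatio μ p₀ g x) - q.eval x| ≤
        96 * (B * m) * (B * m + supKappa μ p₀ m) * Real.exp (-(J / (2 * (B * m)))) := by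
  set ν := g.withDensity fun θ => ENNReal.ofReal (Real.exp (-kappa μ p₀ θ)) with hν
  have hmeas := measurable_kappa hp
  have hmgf : ∀ x, mgf id ν x = likRatio μ p₀ g x := by
    intro x
    rw [mgf, hν, integral_withDensity_eq_integral_toReal_smul (by fun_prop)
      (Eventually.of_forall fun _ => ENNReal.ofReal_lt_top)]
    refine integral_congr_ae (Eventually.of_forall fun θ => ?_)
    simp only [id, smul_eq_mul]
    rw [ENNReal.toReal_ofReal (Real.exp_pos _).le, ← Real.exp_add]
    ring_nf
  have hi := integrable_exp_sub_kappa hp hm hg 0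
  have hfin : IsFiniteMeasure ν := by
    refine isFiniteMeasure_withDensity_ofReal ?_
    simpa using hi.2
  have hνm : ∀ᵐ θ ∂ν, |θ| ≤ m := (withDensity_absolutelyContinuous _ _).ae_le hg
  have hmass : ν.real Set.univ = ∫ θ, Real.exp (θ * 0 - kappa μ p₀ θ) ∂g := by
    rw [← mgf_zero' (X := id), hmgf, likRatio]
  have hlow : Real.exp (-supKappa μ p₀ m) ≤ ν.real Set.univ := by
    rw [hmass]
    calc Real.exp (-supKappa μ p₀ m) = ∫ _, Real.exp (-supKappa μ p₀ m) ∂g := by simp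
      _ ≤ _ := by
        refine integral_mono_ae (integrable_const _) hi ?_
        filter_upwards [hg] with θ hθ
        rw [Real.exp_le_exp]
        have := (abs_le.1 (abs_kappa_le_supKappa hp hm hθ)).2
        linarith
  have hupp : ν.real Set.univ ≤ Real.exp (supKappa μ p₀ m) := by
    rw [hmass]
    calc _ ≤ ∫ _, Real.exp (supKappa μ p₀ m) ∂g := by
          refine integral_mono_ae hi (integrable_const _) ?_
          filter_upwards [hg] with θ hθ
          rw [Real.exp_le_exp]
          have := (abs_le.1 (abs_kappa_le_supKappa hp hm hθ)).1
          linarith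
      _ = _ := by simp
  obtain ⟨q, hq, hqE⟩ := exists_polynomial_approx_cgf hνm hm0 supKappa_nonneg hlow hupp hB hBm hJ
  refine ⟨q, hq, fun x hx => ?_⟩
  rw [← hmgf]
  exact hqE x hx

end Family

/-! ### The likelihood gap -/

lemma logLik_mixDensity {μ : Measure ℝ} {p₀ : ℝ → ℝ} {g : Measure ℝ} {n : ℕ} {x : Fin n → ℝ}
    (hl : ∀ i, 0 < likRatio μ p₀ g (x i)) (hx : ∀ i, 0 < p₀ (x i)) :
    logLik x (mixDensity μ p₀ g)
      = ∑ i, Real.log (likRatio μ p₀ g (x i)) + ∑ i, Real.log (p₀ (x i)) := by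
  rw [logLik, ← Finset.sum_add_distrib]
  refine Finset.sum_congr rfl fun i _ => ?_
  rw [mixDensity_eq, Real.log_mul (hl i).ne' (hx i).ne']

/-- The likelihood gap of the approximate NPMLE when all mixing distributions involved are
supported in `[-m, m]`. -/
lemma logLik_gap_le {μ : Measure ℝ} {p₀ : ℝ → ℝ} {m : ℝ} {M : EReal} (hp : IsBaseDensity μ p₀)
    (hm : Set.Icc (-m) m ⊆ canonicalSpace μ p₀) (hm0 : 0 < m) {n : ℕ} (hn : 1 ≤ n)
    {x : Fin n → ℝ} (hx : ∀ i, 0 < p₀ (x i)) (hBm : 1 ≤ maxAbs x * m) {δ : ℝ} (hδ : 0 < δ)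
    {g gJ Q : Measure ℝ} (hg : g ∈ mixingClass M) (hgm : g.support ⊆ Set.Icc (-m) m)
    (hQ : IsGaussQuadrature (quadOrder μ p₀ 384 x m δ) (empirical x) Q)
    (hgJ : IsApproxNPMLE μ p₀ M Q gJ) (hgJm : gJ.support ⊆ Set.Icc (-m) m) :
    logLik x (mixDensity μ p₀ g) - logLik x (mixDensity μ p₀ gJ) ≤ δ := by
  have hgp := hg.1
  have hgJp := hgJ.1.1
  have ha := ae_abs_le_of_support_subset hgm
  have haJ := ae_abs_le_of_support_subset hgJm
  set B := maxAbs x with hB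
  have hB0 : 0 < B := pos_of_mul_pos_left (by linarith) hm0.le
  set K := supKappa μ p₀ m with hK
  set J := quadOrder μ p₀ 384 x m δ with hJ
  have hK0 : 0 ≤ K := supKappa_nonneg
  have hJ1 : 1 ≤ J := le_max_left _ _
  set Λ := 384 * n * B * m * (B * m + K) / δ with hΛ
  have hn0 : (0 : ℝ) < n := by positivity
  have hΛ0 : 0 < Λ := by positivity
  have hJΛ : 2 * B * m * Real.log Λ ≤ J := by
    refine (Nat.le_ceil _).trans ?_
    exact_mod_cast le_max_right 1 _
  have hexp : Real.exp (-(J / (2 * (B * m)))) ≤ Λ⁻¹ := by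
    rw [← Real.exp_log (inv_pos.2 hΛ0), Real.exp_le_exp, Real.log_inv, neg_le_neg_iff,
      le_div_iff₀ (by positivity)]
    linarith
  obtain ⟨q, hq, hqE⟩ := exists_polynomial_approx_log_likRatio hp hm ha hm0 hB0 hBm hJ1
  obtain ⟨q', hq', hqE'⟩ := exists_polynomial_approx_log_likRatio hp hm haJ hm0 hB0 hBm hJ1
  have e1 := (abs_le.1 (hQ.abs_integral_sub_le hn hq hqE)).2
  have e2 := (abs_le.1 (hQ.abs_integral_sub_le hn hq' hqE')).1
  -- Optimality of `gJ` for the quadrature objective; g acts only as a competitor.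
  have e3 : ∫ y, Real.log (likRatio μ p₀ g y) ∂Q ≤ ∫ y, Real.log (likRatio μ p₀ gJ y) ∂Q :=
    hgJ.2 hg
  have e4 := mul_le_mul_of_nonneg_left e3 hn0.le
  rw [logLik_mixDensity (fun i => likRatio_pos hp hm ha _) hx,
    logLik_mixDensity (fun i => likRatio_pos hp hm haJ _) hx]
  -- Each of g and `gJ` costs twice n times the approximation error, so 4 · 96 = 384 is the
  -- universal constant.
  have e5 : 4 * n * (96 * (B * m) * (B * m + K) * Real.exp (-(J / (2 * (B * m))))) ≤ δ := by
    calc _ ≤ 4 * n * (96 * (B * m) * (B * m + K) * Λ⁻¹) := by gcongr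
      _ = δ := by
        have : B * m + K ≠ 0 := by positivity
        rw [hΛ]; field_simp; norm_num
  linarith

lemma integral_lt_integral_of_not_ae_le {α : Type*} [MeasurableSpace α] {ν : Measure α}
    {f g : α → ℝ} (hf : Integrable f ν) (hg : Integrable g ν) (hle : f ≤ᵐ[ν] g)
    (hlt : ¬ g ≤ᵐ[ν] f) : ∫ x, f x ∂ν < ∫ x, g x ∂ν :=
  lt_of_le_of_ne (integral_mono_ae hf hg hle) fun h =>
    hlt ((integral_eq_iff_of_ae_le hf hg hle).1 h).symm.le

/-! ### Supports of the maximizers for an unbounded parameter set -/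

/-- Jensen's inequality for the concave power u ↦ u^t. It expresses convexity along rays from 0,
where the cumulant generating function vanishes. -/
lemma cgf_mul_le {ν : Measure ℝ} [IsProbabilityMeasure ν] {t θ : ℝ} (ht0 : 0 ≤ t) (ht1 : t ≤ 1)
    (hθ : θ ∈ integrableExpSet id ν) (htθ : t * θ ∈ integrableExpSet id ν) :
    cgf id ν (t * θ) ≤ t * cgf id ν θ := by
  have hpow : ∀ x : ℝ, Real.exp (t * θ * id x) = Real.exp (θ * id x) ^ t := by
    intro x
    rw [← Real.exp_mul]; ring_nf
  have h1 : mgf id ν (t * θ) ≤ mgf id ν θ ^ t := by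
    rw [mgf, mgf]
    have h := (Real.concaveOn_rpow ht0 ht1).le_map_integral (μ := ν)
      (f := fun x => Real.exp (θ * id x))
      (continuousOn_id.rpow_const fun x _ => Or.inr ht0) isClosed_Ici
      (Eventually.of_forall fun x => (Real.exp_pos _).le) hθ
      (htθ.congr (Eventually.of_forall hpow))
    simpa only [hpow] using h
  have hpos : 0 < mgf id ν (t * θ) := mgf_pos htθ
  have hpos' : 0 < mgf id ν θ := mgf_pos hθ
  have := Real.log_le_log hpos h1
  rwa [Real.log_rpow hpos'] at this

section Clamp

variable {μ : Measure ℝ} {p₀ : ℝ → ℝ} {T B : ℝ}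

/-- Truncation to `[-T, T]`. -/
def clamp (T θ : ℝ) : ℝ := max (-T) (min T θ)

lemma measurable_clamp (T : ℝ) : Measurable (clamp T) := by
  unfold clamp; fun_prop

lemma abs_clamp_le (hT : 0 < T) (θ : ℝ) : |clamp T θ| ≤ T :=
  abs_le.2 ⟨le_max_left _ _, max_le (by linarith) (min_le_left _ _)⟩

lemma clamp_eq_self {θ : ℝ} (hθ : |θ| ≤ T) : clamp T θ = θ := by
  rw [clamp, min_eq_right (abs_le.1 hθ).2, max_eq_right (abs_le.1 hθ).1]

/-- With t = T/|θ|, κ(tθ) ≤ tκ(θ) turns BT < κ(±T) into κ(θ) > B|θ|. So θx - κ(θ) is negative, and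
shrinking θ to tθ multiplies it by t < 1 or does even better. -/
lemma tilt_lt_clamp (hp : IsBaseDensity μ p₀) (hΘ : canonicalSpace μ p₀ = Set.univ) (hT : 0 < T)
    (h1 : B * T < kappa μ p₀ T) (h2 : B * T < kappa μ p₀ (-T)) {x θ : ℝ} (hx : |x| ≤ B)
    (hθ : T < |θ|) :
    θ * x - kappa μ p₀ θ < clamp T θ * x - kappa μ p₀ (clamp T θ) := by
  have := hp.isProbabilityMeasure
  have hmem : ∀ θ, θ ∈ integrableExpSet id (baseMeasure μ p₀) := fun θ => by
    change θ ∈ canonicalSpace μ p₀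
    rw [hΘ]; trivial
  obtain ⟨hx1, hx2⟩ := abs_le.1 hx
  have aux : ∀ t : ℝ, 0 < t → t < 1 → B * T < kappa μ p₀ (t * θ) → t * |θ| = T →
      θ * x - kappa μ p₀ θ < t * θ * x - kappa μ p₀ (t * θ) := by
    intro t ht0 ht1 hκ htθ
    have hle : kappa μ p₀ (t * θ) ≤ t * kappa μ p₀ θ := cgf_mul_le ht0.le ht1.le (hmem _) (hmem _)
    have hxθ : θ * x ≤ |θ| * B := by
      refine (le_abs_self _).trans ?_
      rw [abs_mul]; gcongr
    have h3 : t * (B * |θ|) < t * kappa μ p₀ θ := by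
      calc t * (B * |θ|) = B * T := by rw [← htθ]; ring
        _ < _ := hκ.trans_le hle
    have h4 : B * |θ| < kappa μ p₀ θ := lt_of_mul_lt_mul_left h3 ht0.le
    nlinarith
  have hθ0 : 0 < |θ| := hT.trans hθ
  have ht : T / |θ| * |θ| = T := div_mul_cancel₀ _ hθ0.ne'
  have ht1 : T / |θ| < 1 := (div_lt_one hθ0).2 hθ
  have hcl : clamp T θ = T / |θ| * θ := by
    rcases le_total 0 θ with h | h
    · rw [abs_of_nonneg h] at ht hθ ⊢
      rw [ht, clamp, min_eq_left hθ.le, max_eq_right (by linarith)]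
    · rw [abs_of_nonpos h] at ht hθ ⊢
      have : T / -θ * θ = -T := by linarith
      rw [this, clamp, min_eq_right (by linarith), max_eq_left (by linarith)]
  rw [hcl]
  refine aux _ (by positivity) ht1 ?_ ht
  rcases le_total 0 θ with h | h
  · rw [abs_of_nonneg h] at ht ⊢
    rwa [ht]
  · rw [abs_of_nonpos h] at ht ⊢
    have : T / -θ * θ = -T := by linarith
    rwa [this]

variable {g : Measure ℝ} [IsProbabilityMeasure g]

lemma likRatio_map_clamp {g : Measure ℝ} (hp : IsBaseDensity μ p₀) (x : ℝ) :
    likRatio μ p₀ (g.map (clamp T)) x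
      = ∫ θ, Real.exp (clamp T θ * x - kappa μ p₀ (clamp T θ)) ∂g := by
  have := measurable_kappa hp
  exact integral_map (measurable_clamp T).aemeasurable (by fun_prop)

lemma exp_tilt_le_clamp (hp : IsBaseDensity μ p₀) (hΘ : canonicalSpace μ p₀ = Set.univ)
    (hT : 0 < T) (h1 : B * T < kappa μ p₀ T) (h2 : B * T < kappa μ p₀ (-T)) {x : ℝ}
    (hx : |x| ≤ B) (θ : ℝ) :
    Real.exp (θ * x - kappa μ p₀ θ) ≤ Real.exp (clamp T θ * x - kappa μ p₀ (clamp T θ)) := by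
  rcases le_or_gt |θ| T with h | h
  · rw [clamp_eq_self h]
  · exact Real.exp_le_exp.2 (tilt_lt_clamp hp hΘ hT h1 h2 hx h).le

lemma integrable_exp_clamp (hp : IsBaseDensity μ p₀) (hΘ : canonicalSpace μ p₀ = Set.univ)
    (hT : 0 < T) (x : ℝ) :
    Integrable (fun θ => Real.exp (clamp T θ * x - kappa μ p₀ (clamp T θ))) g := by
  have hcl := measurable_clamp T
  have hP : IsProbabilityMeasure (g.map (clamp T)) :=
    Measure.isProbabilityMeasure_map hcl.aemeasurable
  have hae : ∀ᵐ θ ∂(g.map (clamp T)), |θ| ≤ T := by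
    rw [ae_map_iff hcl.aemeasurable (measurableSet_le (by fun_prop) (by fun_prop))]
    exact Eventually.of_forall fun θ => abs_clamp_le hT θ
  exact (integrable_exp_sub_kappa hp (hΘ ▸ Set.subset_univ _) hae x).comp_measurable hcl

/-- Here g need not have bounded support; the bounded clamped integrand dominates. -/
lemma integrable_exp_sub_kappa_of_lt (hp : IsBaseDensity μ p₀)
    (hΘ : canonicalSpace μ p₀ = Set.univ) (hT : 0 < T) (h1 : B * T < kappa μ p₀ T)
    (h2 : B * T < kappa μ p₀ (-T)) {x : ℝ} (hx : |x| ≤ B) :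
    Integrable (fun θ => Real.exp (θ * x - kappa μ p₀ θ)) g := by
  have hmeas := measurable_kappa hp
  refine (integrable_exp_clamp hp hΘ hT x).mono' (by fun_prop) (Eventually.of_forall fun θ => ?_)
  rw [Real.norm_of_nonneg (Real.exp_pos _).le]
  exact exp_tilt_le_clamp hp hΘ hT h1 h2 hx θ

/-- Moving the mass outside `[-T, T]` to the endpoints strictly increases the likelihood. -/
lemma likRatio_lt_map_clamp (hp : IsBaseDensity μ p₀) (hΘ : canonicalSpace μ p₀ = Set.univ)
    (hT : 0 < T) (h1 : B * T < kappa μ p₀ T) (h2 : B * T < kappa μ p₀ (-T))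
    (hg : ¬ ∀ᵐ θ ∂g, |θ| ≤ T) {x : ℝ} (hx : |x| ≤ B) :
    0 < likRatio μ p₀ g x ∧ likRatio μ p₀ g x < likRatio μ p₀ (g.map (clamp T)) x := by
  have i2 : Integrable (fun θ => Real.exp (θ * x - kappa μ p₀ θ)) g :=
    integrable_exp_sub_kappa_of_lt hp hΘ hT h1 h2 hx
  refine ⟨integral_exp_pos i2, ?_⟩
  rw [likRatio_map_clamp hp]
  refine integral_lt_integral_of_not_ae_le i2 (integrable_exp_clamp hp hΘ hT x)
    (Eventually.of_forall (exp_tilt_le_clamp hp hΘ hT h1 h2 hx)) fun h0 => hg ?_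
  filter_upwards [h0] with θ hθ
  by_contra hlt
  exact hθ.not_gt (Real.exp_lt_exp.2 (tilt_lt_clamp hp hΘ hT h1 h2 hx (not_le.1 hlt)))

lemma map_clamp_mem_mixingClass : g.map (clamp T) ∈ mixingClass ⊤ :=
  ⟨Measure.isProbabilityMeasure_map (measurable_clamp T).aemeasurable, by
    simp [paramSet]⟩

lemma support_subset_of_ae_abs_le {g : Measure ℝ} (hg : ∀ᵐ θ ∂g, |θ| ≤ T) : g.support ⊆ Set.Icc (-T) T :=
  Measure.support_subset_of_isClosed isClosed_Icc (hg.mono fun _ h => abs_le.1 h)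

end Clamp

section Support

variable {μ : Measure ℝ} {p₀ : ℝ → ℝ} {T : ℝ} {n : ℕ} {x : Fin n → ℝ} {g : Measure ℝ}

/-- Any mass outside [-T, T] could be clamped, which would strictly increase every summand of the
log-likelihood. -/
lemma IsNPMLE.support_subset (hg : IsNPMLE μ p₀ ⊤ x g) (hp : IsBaseDensity μ p₀)
    (hΘ : canonicalSpace μ p₀ = Set.univ) (hn : 1 ≤ n) (hx : ∀ i, 0 < p₀ (x i)) (hT : 0 < T)
    (h1 : maxAbs x * T < kappa μ p₀ T) (h2 : maxAbs x * T < kappa μ p₀ (-T)) :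
    g.support ⊆ Set.Icc (-T) T := by
  have := hg.1.1
  refine support_subset_of_ae_abs_le ?_
  by_contra hae
  have hlt := fun i => likRatio_lt_map_clamp hp hΘ hT h1 h2 hae (abs_le_maxAbs x i)
  have hmax : logLik x (mixDensity μ p₀ (g.map (clamp T))) ≤ logLik x (mixDensity μ p₀ g) :=
    hg.2 map_clamp_mem_mixingClass
  rw [logLik_mixDensity (fun i => (hlt i).1.trans (hlt i).2) hx,
    logLik_mixDensity (fun i => (hlt i).1) hx] at hmax
  have : ∑ i, Real.log (likRatio μ p₀ g (x i))
      < ∑ i, Real.log (likRatio μ p₀ (g.map (clamp T)) (x i)) :=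
    Finset.sum_lt_sum_of_nonempty ⟨⟨0, hn⟩, Finset.mem_univ _⟩
      fun i _ => Real.log_lt_log (hlt i).1 (hlt i).2
  linarith

/-- The clamping argument carries over because the nodes of Q stay within the data range. -/
lemma IsApproxNPMLE.support_subset {J : ℕ} {Q : Measure ℝ} (hg : IsApproxNPMLE μ p₀ ⊤ Q g)
    (hQ : IsGaussQuadrature J (empirical x) Q) (hp : IsBaseDensity μ p₀)
    (hΘ : canonicalSpace μ p₀ = Set.univ) (hT : 0 < T)
    (h1 : maxAbs x * T < kappa μ p₀ T) (h2 : maxAbs x * T < kappa μ p₀ (-T)) :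
    g.support ⊆ Set.Icc (-T) T := by
  have := hg.1.1
  have := hQ.prob
  refine support_subset_of_ae_abs_le ?_
  by_contra hae
  have hmax : ∫ y, Real.log (likRatio μ p₀ (g.map (clamp T)) y) ∂Q
      ≤ ∫ y, Real.log (likRatio μ p₀ g y) ∂Q := hg.2 map_clamp_mem_mixingClass
  refine hmax.not_gt ?_
  have hlt : ∀ᵐ y ∂Q, Real.log (likRatio μ p₀ g y)
      < Real.log (likRatio μ p₀ (g.map (clamp T)) y) := by
    filter_upwards [hQ.ae_abs_le] with y hy
    have h := likRatio_lt_map_clamp hp hΘ hT h1 h2 hae hy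
    exact Real.log_lt_log h.1 h.2
  refine integral_lt_integral_of_not_ae_le (hQ.integrable _) (hQ.integrable _)
    (hlt.mono fun _ h => h.le) fun hge => ?_
  obtain ⟨y, hy, hy'⟩ := (hlt.and hge).exists
  exact hy.not_ge hy'

end Support

/-! ### The law of the observations -/

section Law

variable {μ : Measure ℝ} {p₀ : ℝ → ℝ} {g₀ : Measure ℝ}

lemma measurable_likRatio [IsProbabilityMeasure g₀] (hp : IsBaseDensity μ p₀) :
    Measurable (likRatio μ p₀ g₀) := by
  have hmeas := measurable_kappa hp
  have : StronglyMeasurable fun p : ℝ × ℝ => Real.exp (p.2 * p.1 - kappa μ p₀ p.2) :=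
    (by fun_prop : Measurable _).stronglyMeasurable
  exact (this.integral_prod_right (ν := g₀)).measurable

lemma withDensity_mixDensity [IsProbabilityMeasure g₀] (hp : IsBaseDensity μ p₀) :
    μ.withDensity (fun x => ENNReal.ofReal (mixDensity μ p₀ g₀ x))
      = (baseMeasure μ p₀).withDensity fun x => ENNReal.ofReal (likRatio μ p₀ g₀ x) := by
  rw [baseMeasure, ← withDensity_mul _ hp.measurable.ennreal_ofReal
    (measurable_likRatio hp).ennreal_ofReal]
  congr 1
  ext x
  rw [mixDensity_eq, mul_comm, ENNReal.ofReal_mul (hp.nonneg x), Pi.mul_apply]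

variable {Ω : Type*} [MeasurableSpace Ω] {P : Measure Ω} {X : ℕ → Ω → ℝ}

/-- The mixture density vanishes wherever p₀ does. Positivity is what allows log f_g to split into
log l_g + log p₀, given the convention `Real.log 0 = 0`. -/
lemma IsIIDSample.ae_pos (hX : IsIIDSample P μ p₀ g₀ X) (hp : IsBaseDensity μ p₀) :
    ∀ᵐ ω ∂P, ∀ i, 0 < p₀ (X i ω) := by
  rw [ae_all_iff]
  intro i
  have hms : MeasurableSet {x | 0 < p₀ x} := measurableSet_lt measurable_const hp.measurable
  have h : ∀ᵐ x ∂(P.map (X i)), 0 < p₀ x := by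
    rw [(hX.law i).map_eq]
    change (μ.withDensity fun x => ENNReal.ofReal (mixDensity μ p₀ g₀ x)) {x | 0 < p₀ x}ᶜ = 0
    rw [withDensity_apply _ hms.compl, setLIntegral_congr_fun (g := fun _ => 0) hms.compl]
    · simp
    · intro x hx
      have : p₀ x = 0 := le_antisymm (not_lt.1 hx) (hp.nonneg x)
      simp [mixDensity_eq, this]
  exact (ae_map_iff (hX.law i).aemeasurable hms).1 h

lemma maxAbs_lt_of_forall {n : ℕ} (hn : 1 ≤ n) {x : Fin n → ℝ} {t : ℝ} (h : ∀ i, |x i| < t) :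
    maxAbs x < t := by
  have : Nonempty (Fin n) := ⟨⟨0, hn⟩⟩
  obtain ⟨i, hi⟩ := exists_eq_ciSup_of_finite (f := fun i => |x i|)
  rw [maxAbs, ← hi]
  exact h i

lemma IsIIDSample.measure_le (hX : IsIIDSample P μ p₀ g₀ X) (t : ℝ) (i : ℕ) :
    P {ω | t ≤ |X i ω|}
      = μ.withDensity (fun x => ENNReal.ofReal (mixDensity μ p₀ g₀ x)) {x | t ≤ |x|} :=
  (hX.law i).measure_eq (p := fun x => t ≤ |x|)
    (measurableSet_le measurable_const (by fun_prop))

lemma IsIIDSample.measure_maxAbs_le (hX : IsIIDSample P μ p₀ g₀ X) {n : ℕ} (hn : 1 ≤ n) (t : ℝ) :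
    P {ω | t ≤ maxAbs (sample X n ω)}
      ≤ n * μ.withDensity (fun x => ENNReal.ofReal (mixDensity μ p₀ g₀ x)) {x | t ≤ |x|} := by
  calc P {ω | t ≤ maxAbs (sample X n ω)} ≤ P (⋃ i ∈ Finset.range n, {ω | t ≤ |X i ω|}) := by
        refine measure_mono fun ω hω => ?_
        by_contra hcon
        simp only [Finset.mem_range, Set.mem_iUnion, Set.mem_ofPred_eq, exists_prop, not_exists,
          not_and, not_le] at hcon hω
        exact hω.not_gt (maxAbs_lt_of_forall hn fun i => hcon i i.2)
    _ ≤ ∑ i ∈ Finset.range n, P {ω | t ≤ |X i ω|} := measure_biUnion_finset_le _ _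
    _ = _ := by simp [hX.measure_le]

/-- For a bounded parameter set with margin, the observations have exponential tails. -/
lemma IsIIDSample.lightTail_one {M : ℝ} (hX : IsIIDSample P μ p₀ g₀ X)
    (hS : ScenarioOne μ p₀ M) (hg₀ : g₀ ∈ mixingClass (M : EReal)) : LightTail P X 1 := by
  have hp := hS.expFamily.density
  have := hp.isProbabilityMeasure
  have hgp := hg₀.1
  obtain ⟨τ, hτ, hτΘ⟩ := hS.margin
  have hM : 0 < M := by exact_mod_cast hS.expFamily.pos
  have hMΘ : Set.Icc (-M) M ⊆ canonicalSpace μ p₀ :=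
    (Set.Icc_subset_Icc (by linarith) (by linarith)).trans hτΘ
  have hae : ∀ᵐ θ ∂g₀, |θ| ≤ M := ae_abs_le_of_support_subset fun θ hθ => by
    have h : ((|θ| : ℝ) : EReal) ≤ M := hg₀.2 hθ
    exact abs_le.1 (EReal.coe_le_coe_iff.1 h)
  set K := supKappa μ p₀ M
  have hlik : ∀ x, likRatio μ p₀ g₀ x ≤ Real.exp (K + M * |x|) := by
    intro x
    calc _ ≤ ∫ _, Real.exp (K + M * |x|) ∂g₀ := by
          refine integral_mono_ae (integrable_exp_sub_kappa hp hMΘ hae x) (integrable_const _) ?_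
          filter_upwards [hae] with θ hθ
          rw [Real.exp_le_exp]
          have h1 := (abs_le.1 (abs_kappa_le_supKappa hp hMΘ hθ)).1
          have h2 : θ * x ≤ M * |x| := by
            refine (le_abs_self _).trans ?_
            rw [abs_mul]; gcongr
          linarith
      _ = _ := by simp
  -- The margin τ makes e^{(M+τ)|x|} integrable, while the likelihood ratio grows at most like
  -- e^{M|x|}; the surplus yields the tail e^{-τt}.
  have hint : Integrable (fun x : ℝ => Real.exp ((M + τ) * |x|)) (baseMeasure μ p₀) :=
    integrable_exp_mul_abs (X := id) (hτΘ ⟨by linarith, le_rfl⟩)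
      (hτΘ ⟨by linarith, by linarith⟩)
  set c := ∫ x : ℝ, Real.exp ((M + τ) * |x|) ∂(baseMeasure μ p₀)
  have hc : 0 < c := integral_exp_pos hint
  have htail : ∀ t : ℝ, μ.withDensity (fun x => ENNReal.ofReal (mixDensity μ p₀ g₀ x)) {x | t ≤ |x|}
      ≤ ENNReal.ofReal (Real.exp (K - τ * t) * c) := by
    intro t
    have hms : MeasurableSet {x : ℝ | t ≤ |x|} := measurableSet_le measurable_const (by fun_prop)
    rw [withDensity_mixDensity hp, withDensity_apply _ hms]
    calc ∫⁻ x in {x : ℝ | t ≤ |x|}, ENNReal.ofReal (likRatio μ p₀ g₀ x) ∂(baseMeasure μ p₀)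
        ≤ ∫⁻ x in {x : ℝ | t ≤ |x|}, ENNReal.ofReal
            (Real.exp (K - τ * t) * Real.exp ((M + τ) * |x|)) ∂(baseMeasure μ p₀) := by
          refine setLIntegral_mono' hms fun x hx => ENNReal.ofReal_le_ofReal ?_
          refine (hlik x).trans ?_
          rw [← Real.exp_add, Real.exp_le_exp]
          have := mul_le_mul_of_nonneg_left (show t ≤ |x| from hx) hτ.le
          linarith
      _ ≤ ∫⁻ x, ENNReal.ofReal
            (Real.exp (K - τ * t) * Real.exp ((M + τ) * |x|)) ∂(baseMeasure μ p₀) :=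
          setLIntegral_le_lintegral _ _
      _ = _ := by
          rw [← ofReal_integral_eq_lintegral_ofReal (hint.const_mul _)
            (Eventually.of_forall fun x => by positivity), integral_const_mul]
  -- Half of the rate τ absorbs the prefactor e^K c once t is this large.
  refine ⟨max 1 (2 / τ * (K + Real.log c)), τ / 2, by positivity, by positivity,
    fun n hn t ht => ?_⟩
  refine (hX.measure_maxAbs_le hn t).trans ?_
  rw [ENNReal.ofReal_mul (Nat.cast_nonneg n), ENNReal.ofReal_natCast]
  gcongr
  refine (htail t).trans (ENNReal.ofReal_le_ofReal ?_)
  rw [← Real.exp_log hc, ← Real.exp_add, Real.exp_le_exp, Real.rpow_one]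
  have h1 : 2 / τ * (K + Real.log c) ≤ t := (le_max_right _ _).trans ht
  have h2 : K + Real.log c ≤ τ / 2 * t := by
    calc K + Real.log c = τ / 2 * (2 / τ * (K + Real.log c)) := by field_simp
      _ ≤ _ := by gcongr
  linarith

/-- Under a light-tail condition, `|X|_n` is of order `(log n) ^ (1 / β₀)`. -/
lemma LightTail.exists_tendsto [IsProbabilityMeasure P] {β₀ : ℝ} (hβ : 0 < β₀)
    (h : LightTail P X β₀) :
    ∃ R : ℝ, 0 < R ∧ Tendsto
      (fun n : ℕ => P {ω | R * Real.log n ^ (1 / β₀) ≤ maxAbs (sample X n ω)}) atTop (𝓝 0) := by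
  obtain ⟨b₀, b₁, -, hb₁, hb⟩ := h
  -- This R makes b₁ t^{β₀} = 2 log n, so the tail bound is n · n^{-2}.
  refine ⟨(2 / b₁) ^ (1 / β₀), by positivity, ?_⟩
  have hlog : Tendsto (fun n : ℕ => Real.log n) atTop atTop :=
    Real.tendsto_log_atTop.comp tendsto_natCast_atTop_atTop
  have ht : Tendsto (fun n : ℕ => (2 / b₁) ^ (1 / β₀) * Real.log n ^ (1 / β₀)) atTop atTop :=
    ((tendsto_rpow_atTop (by positivity)).comp hlog).const_mul_atTop (by positivity)
  have hlim : Tendsto (fun n : ℕ => ENNReal.ofReal ((n : ℝ)⁻¹)) atTop (𝓝 0) := by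
    rw [← ENNReal.ofReal_zero]
    exact ENNReal.tendsto_ofReal tendsto_inv_atTop_nhds_zero_nat
  refine tendsto_of_tendsto_of_tendsto_of_le_of_le' tendsto_const_nhds hlim
    (Eventually.of_forall fun _ => bot_le) ?_
  filter_upwards [ht.eventually_ge_atTop b₀, eventually_ge_atTop 1] with n hn hn1
  refine (hb n hn1 _ hn).trans (ENNReal.ofReal_le_ofReal (le_of_eq ?_))
  have hn0 : (0 : ℝ) < n := by positivity
  have hl : 0 ≤ Real.log n := Real.log_natCast_nonneg n
  rw [← Real.mul_rpow (by positivity) hl, ← Real.rpow_mul (by positivity), one_div_mul_cancel hβ.ne',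
    Real.rpow_one]
  have : -b₁ * (2 / b₁ * Real.log n) = -Real.log n + -Real.log n := by field_simp; ring
  rw [this, Real.exp_add, Real.exp_neg, Real.exp_log hn0]
  field_simp

end Law

/-! ### The order of the quadrature rule -/

section Order

variable {μ : Measure ℝ} {p₀ : ℝ → ℝ}

lemma quadOrder_le {C m δ V W : ℝ} {n : ℕ} {x : Fin n → ℝ} (hC : 0 < C) (hn : 1 ≤ n) (hm : 0 ≤ m)
    (hδ : 0 < δ) (hV0 : 0 < V) (hV : maxAbs x * m ≤ V) (hW : supKappa μ p₀ m ≤ W) {D : ℝ}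
    (hD0 : 0 ≤ D) (hD : Real.log (C * n * V * (V + W) / δ) ≤ D) :
    (quadOrder μ p₀ C x m δ : ℝ) ≤ 1 + 2 * V * D := by
  have hB := maxAbs_nonneg x
  have hBm : 0 ≤ maxAbs x * m := mul_nonneg hB hm
  have hK0 : 0 ≤ supKappa μ p₀ m := supKappa_nonneg
  have hn0 : (0 : ℝ) < n := by positivity
  set U := C * n * maxAbs x * m * (maxAbs x * m + supKappa μ p₀ m) / δ with hU
  have hUle : U ≤ C * n * V * (V + W) / δ := by
    rw [hU]
    have : C * n * maxAbs x * m = C * n * (maxAbs x * m) := by ring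
    rw [this]
    gcongr
  have hU0 : 0 ≤ U := by rw [hU]; positivity
  have hlog : Real.log U ≤ D := by
    -- U = 0 is possible; then `Real.log 0 = 0` and D ≥ 0 suffices.
    rcases hU0.eq_or_lt with h | h
    · rw [← h]; simpa using hD0
    · exact (Real.log_le_log h hUle).trans hD
  have hy : 2 * maxAbs x * m * Real.log U ≤ 2 * V * D := by
    calc _ = 2 * (maxAbs x * m) * Real.log U := by ring
      _ ≤ 2 * (maxAbs x * m) * D := by gcongr
      _ ≤ _ := by gcongr
  change ((max 1 ⌈2 * maxAbs x * m * Real.log U⌉₊ : ℕ) : ℝ) ≤ _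
  rw [Nat.cast_max, Nat.cast_one]
  refine max_le (by linarith [mul_nonneg hV0.le hD0]) ?_
  calc (⌈2 * maxAbs x * m * Real.log U⌉₊ : ℝ) ≤ (⌈2 * V * D⌉₊ : ℝ) := by
        exact_mod_cast Nat.ceil_mono hy
    _ ≤ 2 * V * D + 1 := (Nat.ceil_lt_add_one (by positivity)).le
    _ = _ := by ring

/-- Stochastic order of `J_n` when `|X|_n m_n` is at most of order `(log n) ^ q` and
`sup_{|θ| ≤ m_n} |κ(θ)|` is at most polynomial in `n`, up to events of vanishing probability. -/
lemma isBigOP_quadOrder {Ω : Type*} [MeasurableSpace Ω] {P : Measure Ω} {X : ℕ → Ω → ℝ}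
    {C γ v q w p : ℝ} {Δ : ℕ → ℝ} (hC : 0 < C) (hv : 0 < v) (hq : 0 ≤ q) (hw : 0 ≤ w) (hp : 0 ≤ p)
    (hγ : 0 < γ) (hΔ : IsTolerance γ Δ) {m : ℕ → Ω → ℝ} (hm : ∀ n ω, 0 ≤ m n ω) {S : ℕ → Set Ω}
    (hS : Tendsto (fun n => P (S n)) atTop (𝓝 0))
    (hbd : ∀ᶠ n : ℕ in atTop, ∀ ω, ω ∉ S n → maxAbs (sample X n ω) * m n ω ≤ v * Real.log n ^ q ∧
      supKappa μ p₀ (m n ω) ≤ w * (n : ℝ) ^ p) :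
    IsBigOP P (fun n ω => (quadOrder μ p₀ C (sample X n ω) (m n ω) (Δ n) : ℝ))
      (fun n => Real.log n ^ (1 + q)) := by
  obtain ⟨hΔ0, hΔΘ⟩ := hΔ
  obtain ⟨d, hd, hdle⟩ := hΔΘ.2.exists_pos
  rw [isBigOWith_iff] at hdle
  set a := |Real.log (C * v * (v + w) * d)| with ha
  -- The argument of the logarithm is at most e^a n^{1+q+(q+p)+γ}, so its logarithm is at most D log
  -- n once log n ≥ 1.
  set D := a + (1 + q + (q + p) + γ) with hD
  have hD0 : 0 < D := by positivity
  have hkey : ∀ᶠ n : ℕ in atTop, ∀ ω, ω ∉ S n →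
      (quadOrder μ p₀ C (sample X n ω) (m n ω) (Δ n) : ℝ)
        ≤ (1 + 2 * v * D) * Real.log n ^ (1 + q) := by
    have hlog : Tendsto (fun n : ℕ => Real.log n) atTop atTop :=
      Real.tendsto_log_atTop.comp tendsto_natCast_atTop_atTop
    filter_upwards [hdle, hbd, eventually_ge_atTop 1, hlog.eventually_ge_atTop 1]
      with n hn1 hn2 hn hl ω hω
    obtain ⟨hV, hW⟩ := hn2 ω hω
    have hn0 : (0 : ℝ) < n := by positivity
    have hn1' : (1 : ℝ) ≤ n := by exact_mod_cast hn
    have hl0 : 0 < Real.log n := by linarith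
    have hδ := hΔ0 n hn
    rw [Real.norm_of_nonneg (by positivity), Real.norm_of_nonneg hδ.le, Real.rpow_neg hn0.le] at hn1
    have hδ' : (Δ n)⁻¹ ≤ d * (n : ℝ) ^ γ := by
      rw [inv_le_comm₀ hδ (by positivity), mul_inv]
      rw [inv_mul_le_iff₀ hd]
      exact hn1
    have hlq : Real.log n ^ q ≤ (n : ℝ) ^ q :=
      Real.rpow_le_rpow hl0.le (Real.log_le_self hn0.le) hq
    have hV0 : 0 < v * Real.log n ^ q := by positivity
    have hlogle : Real.log (C * n * (v * Real.log n ^ q) * (v * Real.log n ^ q + w * (n : ℝ) ^ p)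
        / Δ n) ≤ D * Real.log n := by
      have h1 : C * n * (v * Real.log n ^ q) * (v * Real.log n ^ q + w * (n : ℝ) ^ p) / Δ n
          ≤ (C * v * (v + w) * d) * (n : ℝ) ^ (1 + q + (q + p) + γ) := by
        have e1 : (n : ℝ) ^ q ≤ (n : ℝ) ^ (q + p) :=
          Real.rpow_le_rpow_of_exponent_le hn1' (by linarith)
        have e2 : (n : ℝ) ^ p ≤ (n : ℝ) ^ (q + p) :=
          Real.rpow_le_rpow_of_exponent_le hn1' (by linarith)
        rw [div_eq_mul_inv]
        calc _ ≤ C * n * (v * (n : ℝ) ^ q) * (v * (n : ℝ) ^ (q + p) + w * (n : ℝ) ^ (q + p))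
              * (d * (n : ℝ) ^ γ) := by gcongr; exact hlq.trans e1
          _ = (C * v * (v + w) * d) * ((n : ℝ) * (n : ℝ) ^ q * (n : ℝ) ^ (q + p) * (n : ℝ) ^ γ) := by
              ring
          _ = _ := by
              rw [Real.rpow_add hn0 (1 + q + (q + p)) γ, Real.rpow_add hn0 (1 + q) (q + p),
                Real.rpow_add hn0 1 q, Real.rpow_one]
      have h2 := Real.log_le_log (by positivity) h1
      rw [Real.log_mul (by positivity) (by positivity), Real.log_rpow hn0] at h2
      refine h2.trans ?_
      have h3 : Real.log (C * v * (v + w) * d) ≤ a * Real.log n := by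
        calc _ ≤ a * 1 := by rw [mul_one]; exact le_abs_self _
          _ ≤ _ := by gcongr
      rw [hD, add_mul]
      linarith
    refine (quadOrder_le hC hn (hm n ω) hδ hV0 hV hW (by positivity) hlogle).trans ?_
    have h4 : 1 ≤ Real.log n ^ (1 + q) := Real.one_le_rpow hl (by linarith)
    rw [Real.rpow_add hl0, Real.rpow_one] at h4 ⊢
    nlinarith
  intro ε hε
  refine ⟨1 + 2 * v * D, by positivity, ?_⟩
  have hev := hS.eventually_le_const (ENNReal.ofReal_pos.2 hε)
  filter_upwards [hkey, hev] with n h1 h2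
  refine (measure_mono fun ω hω => ?_).trans h2
  by_contra hcon
  have h3 := h1 ω hcon
  have h4 : (1 + 2 * v * D) * Real.log n ^ (1 + q)
      < |(quadOrder μ p₀ C (sample X n ω) (m n ω) (Δ n) : ℝ)| := hω
  rw [Nat.abs_cast] at h4
  linarith

end Order

/-! ### Unbounded parameter sets -/

/-- The second-derivative bound is integrated twice. The exponent is not sharp, but any polynomial
bound on κ serves, since κ enters J_n only inside a logarithm. -/
lemma exists_le_of_iteratedDeriv_two_le {f : ℝ → ℝ} (hf : ContDiff ℝ 2 f) {c₀ c₂ a : ℝ}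
    (hc₀ : 0 < c₀) (hc₂ : 0 < c₂) (ha : 0 < a)
    (h : ∀ θ, c₀ ≤ θ → iteratedDeriv 2 f θ ≤ c₂ * θ ^ (a - 1)) :
    ∃ D, 0 ≤ D ∧ ∀ θ, c₀ ≤ θ → f θ ≤ D * (1 + θ) ^ (a + 2) := by
  set D₁ := |deriv f c₀| + c₂ / c₀ with hD₁
  refine ⟨|f c₀| + D₁, by positivity, fun θ hθ => ?_⟩
  have hθ0 : 0 < θ := by linarith
  have hd1 : Differentiable ℝ f := hf.differentiable (by norm_num)
  have hd2 : Differentiable ℝ (deriv f) :=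
    (contDiff_succ_iff_deriv.1 (by rwa [one_add_one_eq_two] : ContDiff ℝ (1 + 1) f)).2.2.differentiable
      (by norm_num)
  set N := c₂ / c₀ * θ ^ a with hN
  have hN0 : 0 < N := by positivity
  have hdd : ∀ s ∈ interior (Set.Icc c₀ θ), deriv (deriv f) s ≤ N := by
    intro s hs
    rw [interior_Icc] at hs
    have hs0 : 0 < s := hc₀.trans hs.1
    have := h s hs.1.le
    rw [iteratedDeriv_succ, iteratedDeriv_one] at this
    refine this.trans ?_
    -- The exponent a - 1 may be negative, hence s^{a-1} = s^a / s ≤ θ^a / c₀.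
    rw [Real.rpow_sub_one hs0.ne', hN, div_mul_eq_mul_div, mul_div_assoc']
    have : s ^ a ≤ θ ^ a := Real.rpow_le_rpow hs0.le hs.2.le ha.le
    gcongr
    exact hs.1.le
  have hder : ∀ s ∈ Set.Icc c₀ θ, deriv f s ≤ deriv f c₀ + N * θ := by
    intro s hs
    have := (convex_Icc c₀ θ).image_sub_le_mul_sub_of_deriv_le hd2.continuous.continuousOn
      hd2.differentiableOn hdd c₀ ⟨le_rfl, hθ⟩ s hs hs.1
    have : N * (s - c₀) ≤ N * θ := by gcongr; linarith [hs.2]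
    linarith
  have hfin := (convex_Icc c₀ θ).image_sub_le_mul_sub_of_deriv_le hd1.continuous.continuousOn
    hd1.differentiableOn (fun s hs => hder s (interior_subset hs)) c₀ ⟨le_rfl, hθ⟩ θ ⟨hθ, le_rfl⟩ hθ
  have h1θ : (1 : ℝ) ≤ 1 + θ := by linarith
  set Y := (1 + θ) ^ (a + 2) with hY
  have hYge : 1 ≤ Y := Real.one_le_rpow h1θ (by linarith)
  have hθY : θ ≤ Y := by
    calc θ ≤ (1 + θ) ^ (1 : ℝ) := by rw [Real.rpow_one]; linarith
      _ ≤ Y := Real.rpow_le_rpow_of_exponent_le h1θ (by linarith)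
  have hθaY : θ ^ a * θ * θ ≤ Y := by
    have : Y = (1 + θ) ^ a * (1 + θ) * (1 + θ) := by
      rw [hY, Real.rpow_add (by linarith), Real.rpow_two]; ring
    rw [this]
    gcongr <;> linarith
  have e1 : (deriv f c₀ + N * θ) * (θ - c₀) ≤ (|deriv f c₀| + N * θ) * θ := by
    have h1 : (deriv f c₀ + N * θ) * (θ - c₀) ≤ (|deriv f c₀| + N * θ) * (θ - c₀) := by
      have := le_abs_self (deriv f c₀)
      have : 0 ≤ θ - c₀ := by linarith
      gcongr
    refine h1.trans ?_
    gcongr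
    linarith
  calc f θ ≤ |f c₀| * 1 + |deriv f c₀| * θ + c₂ / c₀ * (θ ^ a * θ * θ) := by
        have := le_abs_self (f c₀)
        rw [hN] at *
        linarith
    _ ≤ |f c₀| * Y + |deriv f c₀| * Y + c₂ / c₀ * Y := by gcongr
    _ = _ := by ring

section ScenarioTwo

variable {μ : Measure ℝ} {p₀ : ℝ → ℝ} {α₁ α₂ : ℝ}

lemma ScenarioTwo.canonicalSpace_eq (h : ScenarioTwo μ p₀ α₁ α₂) :
    canonicalSpace μ p₀ = Set.univ :=
  Set.eq_univ_of_forall fun θ => h.expFamily.subset (by simp [paramSet])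

lemma ScenarioTwo.exists_lt_kappa (h : ScenarioTwo μ p₀ α₁ α₂) :
    ∃ A₀ : ℝ, 0 < A₀ ∧ ∀ A, A₀ ≤ A → ∀ B, 1 ≤ B → 0 < A * B ^ α₁ ∧
      B * (A * B ^ α₁) < kappa μ p₀ (A * B ^ α₁) ∧ B * (A * B ^ α₁) < kappa μ p₀ (-(A * B ^ α₁)) := by
  obtain ⟨c₀, c₁, c₂, hc₀, hc₁, -, hgr⟩ := h.growth
  have hα : 0 < α₁ := h.pos.trans_le h.le
  -- A ≥ c₀ and B ≥ 1 place T = A B^{α₁} in the range of the growth condition. The second bound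
  -- gives c₁ T^{1/α₁} ≥ 2B, hence κ(±T) ≥ 2BT, and the factor 2 gives strictness.
  refine ⟨max c₀ ((2 / c₁) ^ α₁), lt_max_of_lt_left hc₀, fun A hA B hB => ?_⟩
  have hA0 : c₀ ≤ A := (le_max_left _ _).trans hA
  have hA1 : (2 / c₁) ^ α₁ ≤ A := (le_max_right _ _).trans hA
  have hApos : 0 < A := hc₀.trans_le hA0
  have hBpos : 0 < B := by linarith
  have hT : 0 < A * B ^ α₁ := by positivity
  have hcT : c₀ ≤ A * B ^ α₁ :=
    hA0.trans (le_mul_of_one_le_right hApos.le (Real.one_le_rpow hB hα.le))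
  have hpow : 2 / c₁ * B ≤ (A * B ^ α₁) ^ (1 / α₁) := by
    rw [Real.mul_rpow hApos.le (by positivity), ← Real.rpow_mul hBpos.le, mul_one_div_cancel hα.ne',
      Real.rpow_one]
    gcongr
    calc 2 / c₁ = ((2 / c₁) ^ α₁) ^ (1 / α₁) := by
          rw [← Real.rpow_mul (by positivity), mul_one_div_cancel hα.ne', Real.rpow_one]
      _ ≤ _ := by gcongr
  have hlt : B * (A * B ^ α₁) < c₁ * (A * B ^ α₁) ^ (1 + 1 / α₁) := by
    rw [Real.rpow_add hT, Real.rpow_one]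
    calc B * (A * B ^ α₁) < 2 * (B * (A * B ^ α₁)) := by linarith [mul_pos hBpos hT]
      _ = c₁ * (A * B ^ α₁ * (2 / c₁ * B)) := by field_simp
      _ ≤ _ := by gcongr
  refine ⟨hT, hlt.trans_le ?_, hlt.trans_le ?_⟩
  · have := (hgr (A * B ^ α₁) (by rwa [abs_of_pos hT])).1
    rwa [abs_of_pos hT] at this
  · have := (hgr (-(A * B ^ α₁)) (by rwa [abs_neg, abs_of_pos hT])).1
    rwa [abs_neg, abs_of_pos hT] at this

lemma ScenarioTwo.contDiff_kappa (h : ScenarioTwo μ p₀ α₁ α₂) : ContDiff ℝ 2 (kappa μ p₀) := by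
  have hp := h.expFamily.density.isProbabilityMeasure
  rw [contDiff_iff_contDiffAt]
  intro θ
  have hΘ : integrableExpSet id (baseMeasure μ p₀) = Set.univ := h.canonicalSpace_eq
  exact (analyticAt_cgf (by simp [hΘ])).contDiffAt

/-- Beyond c₀ the growth condition makes κ nonnegative, so upper bounds on κ(θ) and on κ(-θ) control
|κ|; the middle range contributes a constant. -/
lemma ScenarioTwo.exists_supKappa_le (h : ScenarioTwo μ p₀ α₁ α₂) :
    ∃ D p : ℝ, 0 ≤ D ∧ 0 ≤ p ∧ ∀ m, 0 ≤ m → supKappa μ p₀ m ≤ D * (1 + m) ^ p := by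
  obtain ⟨c₀, c₁, c₂, hc₀, hc₁, hc₂, hgr⟩ := h.growth
  have ha : 0 < 1 / α₂ := one_div_pos.2 h.pos
  obtain ⟨D₁, hD₁, h1⟩ := exists_le_of_iteratedDeriv_two_le h.contDiff_kappa hc₀ hc₂ ha
    fun θ hθ => by
      have hθ' : |θ| = θ := abs_of_pos (hc₀.trans_le hθ)
      have := (hgr θ (by rwa [hθ'])).2
      rwa [hθ'] at this
  obtain ⟨D₂, hD₂, h2⟩ := exists_le_of_iteratedDeriv_two_le
    (f := fun θ => kappa μ p₀ (-θ)) (h.contDiff_kappa.comp contDiff_neg) hc₀ hc₂ ha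
    fun θ hθ => by
      have hθ' : |(-θ)| = θ := by rw [abs_neg]; exact abs_of_pos (hc₀.trans_le hθ)
      have := (hgr (-θ) (by rwa [hθ'])).2
      rw [hθ'] at this
      rw [iteratedDeriv_comp_neg]
      simpa using this
  have hK0 : 0 ≤ supKappa μ p₀ c₀ := supKappa_nonneg
  have hp : 0 ≤ 1 / α₂ + 2 := by positivity
  refine ⟨supKappa μ p₀ c₀ + D₁ + D₂, 1 / α₂ + 2, by positivity, hp, fun m hm => ?_⟩
  refine csSup_le (Set.image_nonempty.2 ⟨0, by simpa using hm⟩) ?_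
  rintro _ ⟨θ, hθ, rfl⟩
  have hθm : |θ| ≤ m := abs_le.2 hθ
  have hY1 : 1 ≤ (1 + m) ^ (1 / α₂ + 2) := Real.one_le_rpow (by linarith) hp
  have hYθ : (1 + |θ|) ^ (1 / α₂ + 2) ≤ (1 + m) ^ (1 / α₂ + 2) := by gcongr
  have hnn : 0 ≤ (1 + |θ|) ^ (1 / α₂ + 2) := by positivity
  simp only
  rcases le_total |θ| c₀ with hle | hle
  · have := abs_kappa_le_supKappa h.expFamily.density (h.canonicalSpace_eq ▸ Set.subset_univ _) hle
    nlinarith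
  · have hnonneg : 0 ≤ kappa μ p₀ θ := le_trans (by positivity) (hgr θ hle).1
    rw [abs_of_nonneg hnonneg]
    rcases le_total 0 θ with hs | hs
    · rw [abs_of_nonneg hs] at hle hYθ hnn
      have := h1 θ hle
      nlinarith
    · rw [abs_of_nonpos hs] at hle hYθ hnn
      have := h2 (-θ) hle
      simp only [neg_neg] at this
      nlinarith

lemma ScenarioTwo.likRatio_pos (h : ScenarioTwo μ p₀ α₁ α₂) {g₀ : Measure ℝ}
    [IsProbabilityMeasure g₀] (x : ℝ) : 0 < likRatio μ p₀ g₀ x := by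
  obtain ⟨A₀, -, hA⟩ := h.exists_lt_kappa
  obtain ⟨hT, h1, h2⟩ := hA A₀ le_rfl (max 1 |x|) (le_max_left _ _)
  exact integral_exp_pos (integrable_exp_sub_kappa_of_lt h.expFamily.density h.canonicalSpace_eq
    hT h1 h2 (le_max_right _ _))

/-- A base measure carried by |x| ≤ 1 would give κ(T) ≤ T, against superlinear growth. -/
lemma ScenarioTwo.baseMeasure_ne_zero (h : ScenarioTwo μ p₀ α₁ α₂) :
    baseMeasure μ p₀ {x | 1 ≤ |x|} ≠ 0 := by
  intro h0
  have := h.expFamily.density.isProbabilityMeasure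
  obtain ⟨A₀, -, hA⟩ := h.exists_lt_kappa
  obtain ⟨hT, h1, -⟩ := hA A₀ le_rfl 1 le_rfl
  set T := A₀ * 1 ^ α₁
  have hmem : T ∈ integrableExpSet id (baseMeasure μ p₀) := by
    change T ∈ canonicalSpace μ p₀
    rw [h.canonicalSpace_eq]; trivial
  have hae : ∀ᵐ x ∂(baseMeasure μ p₀), |x| ≤ 1 := by
    refine measure_mono_null (fun x hx => ?_) h0
    have hx' : ¬ |x| ≤ 1 := hx
    exact (not_le.1 hx').le
  have hle : mgf id (baseMeasure μ p₀) T ≤ Real.exp T := by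
    calc mgf id (baseMeasure μ p₀) T ≤ ∫ _, Real.exp T ∂(baseMeasure μ p₀) := by
          refine integral_mono_ae hmem (integrable_const _) ?_
          filter_upwards [hae] with x hx
          rw [Real.exp_le_exp]
          have := (abs_le.1 hx).2
          exact mul_le_of_le_one_right hT.le this
      _ = _ := by simp
  have hlog := Real.log_le_log (mgf_pos hmem) hle
  rw [Real.log_exp] at hlog
  have : kappa μ p₀ T ≤ T := hlog
  linarith

/-- Since l_{g₀} > 0, the law of X_i charges {|x| ≥ 1}. By independence, N observations all stay
below 1 with geometrically small probability, and a single exceedance persists in every later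
maximum. -/
lemma ScenarioTwo.ae_eventually_one_le_maxAbs (h : ScenarioTwo μ p₀ α₁ α₂) {g₀ : Measure ℝ}
    [IsProbabilityMeasure g₀] {Ω : Type*} [MeasurableSpace Ω] {P : Measure Ω}
    [IsProbabilityMeasure P] {X : ℕ → Ω → ℝ} (hX : IsIIDSample P μ p₀ g₀ X) :
    ∀ᵐ ω ∂P, ∀ᶠ n in atTop, 1 ≤ maxAbs (sample X n ω) := by
  have hp := h.expFamily.density
  have hms : MeasurableSet {x : ℝ | |x| < 1} := measurableSet_lt (by fun_prop) measurable_const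
  set ν := μ.withDensity fun x => ENNReal.ofReal (mixDensity μ p₀ g₀ x) with hν
  have hlaw : ∀ i, P (X i ⁻¹' {x | |x| < 1}) = ν {x | |x| < 1} := fun i =>
    (hX.law i).measure_eq hms
  have hνP : IsProbabilityMeasure ν := by
    rw [hν, ← (hX.law 0).map_eq]
    exact Measure.isProbabilityMeasure_map (hX.law 0).aemeasurable
  have hlt : ν {x | |x| < 1} < 1 := by
    refine lt_of_le_of_ne prob_le_one fun h1 => h.baseMeasure_ne_zero ?_
    have h2 : ν {x | 1 ≤ |x|} = 0 := by
      have := (prob_compl_eq_zero_iff hms).2 h1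
      refine measure_mono_null (fun x hx => ?_) this
      have hx' : 1 ≤ |x| := hx
      exact fun hlt : |x| < 1 => hx'.not_gt hlt
    rw [hν, withDensity_mixDensity hp,
      withDensity_apply_eq_zero (measurable_likRatio hp).ennreal_ofReal] at h2
    refine measure_mono_null (fun x hx => ?_) h2
    have hx' : ENNReal.ofReal (likRatio μ p₀ g₀ x) ≠ 0 :=
      (ENNReal.ofReal_pos.2 (h.likRatio_pos x)).ne'
    exact ⟨hx', hx⟩
  have hle : ∀ N : ℕ, P {ω | ∀ i, |X i ω| < 1} ≤ (ν {x | |x| < 1}) ^ N := by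
    intro N
    have hind := hX.indep.measure_inter_preimage_eq_mul (Finset.range N)
      (sets := fun _ => {x | |x| < 1}) fun _ _ => hms
    simp only [hlaw, Finset.prod_const, Finset.card_range] at hind
    rw [← hind]
    refine measure_mono fun ω hω => ?_
    simp only [Set.mem_iInter]
    exact fun i _ => hω i
  have hzero : P {ω | ∀ i, |X i ω| < 1} = 0 :=
    le_antisymm (ge_of_tendsto' (ENNReal.tendsto_pow_atTop_nhds_zero_of_lt_one hlt) hle) bot_le
  have hae : ∀ᵐ ω ∂P, ¬ ∀ i, |X i ω| < 1 := measure_eq_zero_iff_ae_notMem.1 hzero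
  filter_upwards [hae] with ω hω
  push Not at hω
  obtain ⟨i, hi⟩ := hω
  filter_upwards [eventually_gt_atTop i] with n hn
  exact hi.trans (abs_le_maxAbs (sample X n ω) ⟨i, hn⟩)

end ScenarioTwo

/-! ### The two scenarios -/

section Main

variable {μ : Measure ℝ} {p₀ : ℝ → ℝ} {g₀ : Measure ℝ} {Ω : Type*} [MeasurableSpace Ω]
  {P : Measure Ω} {X : ℕ → Ω → ℝ} {γ : ℝ} {Δ : ℕ → ℝ}

lemma ScenarioOne.ae_gapGuarantee {M m : ℝ} (hS : ScenarioOne μ p₀ M) (hMm : M ≤ m)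
    (hm : Set.Icc (-m) m ⊆ canonicalSpace μ p₀) (hX : IsIIDSample P μ p₀ g₀ X)
    (hΔ : IsTolerance γ Δ) :
    ∀ᵐ ω ∂P, ∀ n : ℕ, 1 ≤ n → 1 ≤ maxAbs (sample X n ω) * m →
      GapGuarantee μ p₀ (M : EReal) (sample X n ω)
        (quadOrder μ p₀ 384 (sample X n ω) m (Δ n)) m (Δ n) := by
  have hp := hS.expFamily.density
  have hM : 0 < M := by exact_mod_cast hS.expFamily.pos
  have hsupp : ∀ g ∈ mixingClass (M : EReal), g.support ⊆ Set.Icc (-m) m := by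
    intro g hg θ hθ
    have h : ((|θ| : ℝ) : EReal) ≤ M := hg.2 hθ
    exact abs_le.1 ((EReal.coe_le_coe_iff.1 h).trans hMm)
  filter_upwards [hX.ae_pos hp] with ω hω n hn hBm gHat Q gJ hg hQ hgJ
  exact ⟨Set.union_subset (hsupp _ hg.1) (hsupp _ hgJ.1),
    logLik_gap_le hp hm (hM.trans_le hMm) hn (fun i => hω i) hBm (hΔ.1 n hn) hg.1
      (hsupp _ hg.1) hQ hgJ (hsupp _ hgJ.1)⟩

lemma ScenarioOne.isBigOP_quadOrder [IsProbabilityMeasure P] {M m : ℝ} (hS : ScenarioOne μ p₀ M)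
    (hMm : M ≤ m) (hg₀ : g₀ ∈ mixingClass (M : EReal)) (hX : IsIIDSample P μ p₀ g₀ X)
    (hγ : 0 < γ) (hΔ : IsTolerance γ Δ) {C : ℝ} (hC : 0 < C) :
    IsBigOP P (fun n ω => (quadOrder μ p₀ C (sample X n ω) m (Δ n) : ℝ))
      (fun n => Real.log n ^ 2) := by
  have hM : 0 < M := by exact_mod_cast hS.expFamily.pos
  have hm0 : 0 < m := hM.trans_le hMm
  obtain ⟨R, hR, hlim⟩ := (hX.lightTail_one hS hg₀).exists_tendsto one_pos
  -- With m fixed, sup |κ| is constant, so p = 0; exponential tails give |X|_n of order log n, so q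
  -- = 1.
  have := NPMLE.isBigOP_quadOrder (μ := μ) (p₀ := p₀) (v := R * m) (q := 1)
    (w := supKappa μ p₀ m) (p := 0) hC (by positivity) zero_le_one supKappa_nonneg le_rfl hγ hΔ
    (m := fun _ _ => m) (fun _ _ => hm0.le) hlim <| by
      refine Eventually.of_forall fun n ω hω => ⟨?_, by simp⟩
      have h1 : maxAbs (sample X n ω) < R * Real.log n ^ (1 / 1 : ℝ) := not_le.1 hω
      rw [one_div_one] at h1
      calc _ ≤ R * Real.log n ^ (1 : ℝ) * m := by gcongr
        _ = _ := by ring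
  simpa only [one_add_one_eq_two, Real.rpow_two] using this

variable {α₁ α₂ A β₀ : ℝ}

lemma ScenarioTwo.ae_gapGuarantee (hS : ScenarioTwo μ p₀ α₁ α₂)
    (hA : ∀ B, 1 ≤ B → 0 < A * B ^ α₁ ∧ B * (A * B ^ α₁) < kappa μ p₀ (A * B ^ α₁) ∧
      B * (A * B ^ α₁) < kappa μ p₀ (-(A * B ^ α₁)))
    (hA1 : 1 ≤ A) (hX : IsIIDSample P μ p₀ g₀ X) (hΔ : IsTolerance γ Δ) :
    ∀ᵐ ω ∂P, ∀ n : ℕ, 1 ≤ n → 1 ≤ maxAbs (sample X n ω) →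
      GapGuarantee μ p₀ ⊤ (sample X n ω)
        (quadOrder μ p₀ 384 (sample X n ω) (A * maxAbs (sample X n ω) ^ α₁) (Δ n))
        (A * maxAbs (sample X n ω) ^ α₁) (Δ n) := by
  have hp := hS.expFamily.density
  have hα : 0 < α₁ := hS.pos.trans_le hS.le
  filter_upwards [hX.ae_pos hp] with ω hω n hn hB gHat Q gJ hg hQ hgJ
  obtain ⟨hT, h1, h2⟩ := hA _ hB
  have s1 := hg.support_subset hp hS.canonicalSpace_eq hn (fun i => hω i) hT h1 h2
  have s2 := hgJ.support_subset hQ hp hS.canonicalSpace_eq hT h1 h2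
  have hm1 : 1 ≤ A * maxAbs (sample X n ω) ^ α₁ :=
    one_le_mul_of_one_le_of_one_le hA1 (Real.one_le_rpow hB hα.le)
  exact ⟨Set.union_subset s1 s2,
    logLik_gap_le hp (hS.canonicalSpace_eq ▸ Set.subset_univ _) hT hn (fun i => hω i)
      (one_le_mul_of_one_le_of_one_le hB hm1) (hΔ.1 n hn) hg.1 s1 hQ hgJ s2⟩

lemma ScenarioTwo.isBigOP_quadOrder [IsProbabilityMeasure P] (hS : ScenarioTwo μ p₀ α₁ α₂)
    (hA : 0 < A) (hβ : 0 < β₀) (hLT : LightTail P X β₀)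
    (hγ : 0 < γ) (hΔ : IsTolerance γ Δ) {C : ℝ} (hC : 0 < C) :
    IsBigOP P (fun n ω => (quadOrder μ p₀ C (sample X n ω)
        (A * maxAbs (sample X n ω) ^ α₁) (Δ n) : ℝ))
      (fun n => Real.log n ^ (1 + (1 + α₁) / β₀)) := by
  have hα : 0 < α₁ := hS.pos.trans_le hS.le
  obtain ⟨R, hR, hlim⟩ := hLT.exists_tendsto hβ
  obtain ⟨D, p, hD, hp, hK⟩ := hS.exists_supKappa_le
  have hlog : Tendsto (fun n : ℕ => Real.log n) atTop atTop :=
    Real.tendsto_log_atTop.comp tendsto_natCast_atTop_atTop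
  -- |X|_n M_n = A |X|_n^{1+α₁}, which dictates q; powers of log n inside the bound on κ are crudely
  -- replaced by powers of n.
  refine NPMLE.isBigOP_quadOrder (v := A * R ^ (1 + α₁)) (q := (1 + α₁) / β₀)
    (w := D * (1 + A * R ^ α₁) ^ p) (p := α₁ / β₀ * p) hC (by positivity) (by positivity)
    (by positivity) (by positivity) hγ hΔ (fun n ω => ?_) hlim ?_
  · have := maxAbs_nonneg (sample X n ω)
    positivity
  · filter_upwards [hlog.eventually_ge_atTop 1, eventually_ge_atTop 1] with n hl hn ω hω
    have hB : maxAbs (sample X n ω) < R * Real.log n ^ (1 / β₀) := not_le.1 hω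
    have hB0 := maxAbs_nonneg (sample X n ω)
    set B := maxAbs (sample X n ω)
    have hl0 : 0 < Real.log n := by linarith
    have hn1 : (1 : ℝ) ≤ n := by exact_mod_cast hn
    have hn0 : (0 : ℝ) < n := by linarith
    have hpow : ∀ s : ℝ, 0 ≤ s → B ^ s ≤ R ^ s * Real.log n ^ (s / β₀) := by
      intro s hs
      calc B ^ s ≤ (R * Real.log n ^ (1 / β₀)) ^ s := by gcongr
        _ = _ := by
          rw [Real.mul_rpow hR.le (by positivity), ← Real.rpow_mul hl0.le]
          congr 2
          ring
    constructor
    · calc B * (A * B ^ α₁) = A * B ^ (1 + α₁) := by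
            rw [Real.rpow_one_add' hB0 (by positivity)]; ring
        _ ≤ A * (R ^ (1 + α₁) * Real.log n ^ ((1 + α₁) / β₀)) := by
            gcongr
            exact hpow _ (by positivity)
        _ = _ := by ring
    · have h1 : Real.log n ^ (α₁ / β₀) ≤ (n : ℝ) ^ (α₁ / β₀) :=
        Real.rpow_le_rpow hl0.le (Real.log_le_self hn0.le) (by positivity)
      have h2 : (1 : ℝ) ≤ (n : ℝ) ^ (α₁ / β₀) := Real.one_le_rpow hn1 (by positivity)
      calc supKappa μ p₀ (A * B ^ α₁) ≤ D * (1 + A * B ^ α₁) ^ p := hK _ (by positivity)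
        _ ≤ D * ((1 + A * R ^ α₁) * (n : ℝ) ^ (α₁ / β₀)) ^ p := by
            gcongr
            calc 1 + A * B ^ α₁ ≤ 1 * (n : ℝ) ^ (α₁ / β₀) + A * (R ^ α₁ * (n : ℝ) ^ (α₁ / β₀)) := by
                  rw [one_mul]
                  gcongr
                  exact (hpow _ hα.le).trans (by gcongr)
              _ = _ := by ring
        _ = _ := by
            rw [Real.mul_rpow (by positivity) (by positivity), ← Real.rpow_mul hn0.le]
            ring

end Main

end NPMLE

theorem mainTheorem2 :
    ∃ C : ℝ, 0 < C ∧
      -- bounded parameter set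
      (∀ (μ : Measure ℝ) (p₀ : ℝ → ℝ) (M : ℝ), NPMLE.ScenarioOne μ p₀ M →
        ∀ m : ℝ, M ≤ m → Set.Icc (-m) m ⊆ NPMLE.canonicalSpace μ p₀ →
        ∀ g₀ ∈ NPMLE.mixingClass (M : EReal),
        ∀ (Ω : Type*) [MeasurableSpace Ω] (P : Measure Ω) [IsProbabilityMeasure P]
          (X : ℕ → Ω → ℝ), NPMLE.IsIIDSample P μ p₀ g₀ X →
        ∀ (γ : ℝ) (Δ : ℕ → ℝ), 0 < γ → NPMLE.IsTolerance γ Δ →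
          (∀ᵐ ω ∂P, ∀ n : ℕ, 1 ≤ n → 1 ≤ NPMLE.maxAbs (NPMLE.sample X n ω) * m →
            NPMLE.GapGuarantee μ p₀ (M : EReal) (NPMLE.sample X n ω)
              (NPMLE.quadOrder μ p₀ C (NPMLE.sample X n ω) m (Δ n)) m (Δ n)) ∧
          NPMLE.IsBigOP P
            (fun n ω => (NPMLE.quadOrder μ p₀ C (NPMLE.sample X n ω) m (Δ n) : ℝ))
            (fun n => Real.log n ^ 2)) ∧
      -- unbounded parameter set, light tails
      (∀ (μ : Measure ℝ) (p₀ : ℝ → ℝ) (α₁ α₂ : ℝ), NPMLE.ScenarioTwo μ p₀ α₁ α₂ →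
        ∃ A₀ : ℝ, 0 < A₀ ∧ ∀ A : ℝ, A₀ ≤ A →
        ∀ g₀ ∈ NPMLE.mixingClass ⊤,
        ∀ (Ω : Type*) [MeasurableSpace Ω] (P : Measure Ω) [IsProbabilityMeasure P]
          (X : ℕ → Ω → ℝ), NPMLE.IsIIDSample P μ p₀ g₀ X →
        ∀ β₀ : ℝ, 0 < β₀ → NPMLE.LightTail P X β₀ →
        ∀ (γ : ℝ) (Δ : ℕ → ℝ), 0 < γ → NPMLE.IsTolerance γ Δ →
          (∀ᵐ ω ∂P, ∀ n : ℕ, 1 ≤ n → 1 ≤ NPMLE.maxAbs (NPMLE.sample X n ω) →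
            NPMLE.GapGuarantee μ p₀ ⊤ (NPMLE.sample X n ω)
              (NPMLE.quadOrder μ p₀ C (NPMLE.sample X n ω)
                (A * NPMLE.maxAbs (NPMLE.sample X n ω) ^ α₁) (Δ n))
              (A * NPMLE.maxAbs (NPMLE.sample X n ω) ^ α₁) (Δ n)) ∧
          (∀ᵐ ω ∂P, ∀ᶠ n in atTop, 1 ≤ NPMLE.maxAbs (NPMLE.sample X n ω)) ∧
          NPMLE.IsBigOP P
            (fun n ω => (NPMLE.quadOrder μ p₀ C (NPMLE.sample X n ω)
              (A * NPMLE.maxAbs (NPMLE.sample X n ω) ^ α₁) (Δ n) : ℝ))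
            (fun n => Real.log n ^ (1 + (1 + α₁) / β₀))) := by
  refine ⟨384, by norm_num, ?_, ?_⟩
  · intro μ p₀ M hS m hMm hm g₀ hg₀ Ω _ P _ X hX γ Δ hγ hΔ
    exact ⟨hS.ae_gapGuarantee hMm hm hX hΔ, hS.isBigOP_quadOrder hMm hg₀ hX hγ hΔ (by norm_num)⟩
  · intro μ p₀ α₁ α₂ hS
    obtain ⟨A₀, hA₀, hA⟩ := hS.exists_lt_kappa
    -- A ≥ 1 ensures |X|_n M_n ≥ 1 whenever |X|_n ≥ 1, as the approximation bound requires.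
    refine ⟨max A₀ 1, lt_max_of_lt_left hA₀, ?_⟩
    intro A hA' g₀ hg₀ Ω _ P _ X hX β₀ hβ hLT γ Δ hγ hΔ
    have hg₀p := hg₀.1
    have hA1 : 1 ≤ A := (le_max_right _ _).trans hA'
    exact ⟨hS.ae_gapGuarantee (hA A ((le_max_left _ _).trans hA')) hA1 hX hΔ,
      hS.ae_eventually_one_le_maxAbs hX,
      hS.isBigOP_quadOrder (by linarith) hβ hLT hγ hΔ (by norm_num)⟩
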